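/- Let $(\mathcal A,\varphi)$ be a non-commutative probability space, that is, a unital complex algebra with a linear functional $\varphi$ such that $\varphi(1)=1$. Let $z'=((z'_i)_{i\in I},(z'_j)_{j\in J})$ and $z''=((z''_i)_{i\in I},(z''_j)_{j\in J})$ be two two-faced families in $\mathcal A$, with left face indexed by $I$ and right face indexed by $J$, where $I$ and $J$ are disjoint. **Bi-freeness.** A vector space with specified state-vector is a complex vector space $\mathcal X$ with a vector $\xi\neq 0$ and a projection $p$ onto $\mathbb C\xi$; put $\mathcal X^\circ=\ker p$, and let $T\mapsto\varphi(T)$, with $p(T\xi)=\varphi(T)\xi$, be the state on the algebra $\mathcal L(\mathcal X)$ of linear operators. The free product $(\mathcal X,p,\xi)$ of $(\mathcal X',p',\xi')$ and $(\mathcal X'',p'',\xi'')$ is $\mathcal X=\mathbb C\xi\oplus\bigoplus_{m\ge1}\bigoplus_{\delta_1\neq\delta_2\neq\cdots\neq\delta_m}\mathcal X^{\delta_1\circ}\otimes\cdots\otimes\mathcal X^{\delta_m\circ}$ with $\delta_k\in\{','' \}$. The left and right representations of $\mathcal L(\mathcal X^\delta)$ on $\mathcal X$ are $\lambda^\delta(T)=V_\delta(T\otimes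 1)V_\delta^{-1}$ and $\rho^\delta(T)=W_\delta(1\otimes T)W_\delta^{-1}$, where $V_\delta:\mathcal X^\delta\otimes\mathcal X(\ell,\delta)\to\mathcal X$ and $W_\delta:\mathcal X(r,\delta)\otimes\mathcal X^\delta\to\mathcal X$ are the canonical identifications, and $\mathcal X(\ell,\delta)$ (resp. $\mathcal X(r,\delta)$) is the sum of $\mathbb C\xi$ and the summands above with $\delta_1\neq\delta$ (resp. $\delta_m\neq\delta$). The families $z',z''$ are *bi-free* if there are vector spaces with specified state-vectors $(\mathcal X^\delta,p^\delta,\xi^\delta)$ and unital homomorphisms $l^\delta:\mathbb C\langle z_i^\delta: i\in I\rangle\to\mathcal L(\mathcal X^\delta)$ and $r^\delta:\mathbb C\langle z_j^\delta: j\in J\rangle\to\mathcal L(\mathcal X^\delta)$, $\delta\in\{',''\}$, defined on the unital subalgebras of $\mathcal A$ generated by the faces, such that the two-faced families $\big((\lambda^\delta(l^\delta(z_i^\delta)))_{i\in I},(\rho^\delta(r^\delta(z_j^\delta)))_{j\in J}\big)$, $\delta\in\{',''\}$, have in $\mathcal L(\mathcal X)$ the same joint distribution (all joint non-commutative moments)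 as $z',z''$ have in $(\mathcal A,\varphi)$. **Bi-non-crossing partitions.** For $\alpha:\{1,\dots,n\}\to I\sqcup J$ let $\alpha^{-1}(I)=\{i_1<\cdots<i_p\}$ and $\alpha^{-1}(J)=\{j_1<\cdots<j_{n-p}\}$, and let $s_\alpha$ be the permutation with $s_\alpha(k)=i_k$ for $k\le p$ and $s_\alpha(k)=j_{n+1-k}$ for $k>p$. Let $BNC(\alpha)$ be the set of partitions $\pi$ of $\{1,\dots,n\}$ such that $s_\alpha^{-1}\cdot\pi$ is non-crossing, ordered by refinement ($\pi\le\sigma$ if every block of $\pi$ lies in a block of $\sigma$), and let $\mu_{BNC}$ be the Möbius function of this finite lattice. A shading $\epsilon\in\{',''\}^n$ is identified with the partition of $\{1,\dots,n\}$ into the sets on which it is constant equal to $'$ and to $''$. Put $z^\epsilon=(z^{\epsilon_1}_{\alpha(1)},\dots,z^{\epsilon_n}_{\alpha(n)})$, $\varphi_\alpha(z^\epsilon)=\varphi(z^{\epsilon_1}_{\alpha(1)}\cdots z^{\epsilon_n}_{\alpha(n)})$, and $$\varphi_\pi(z^\epsilon)=\prod_{V=\{k_1<\cdots<k_m\}\in\pi}\varphi\big(z^{\epsilon_{k_1}}_{\alpha(k_1)}\cdots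 z^{\epsilon_{k_m}}_{\alpha(k_m)}\big).$$ **Statement.** $z'$ and $z''$ are bi-free if and only if for every $n$, every $\alpha:\{1,\dots,n\}\to I\sqcup J$ and every shading $\epsilon\in\{',''\}^n$, $$\varphi_\alpha(z^\epsilon)=\sum_{\pi\in BNC(\alpha)}\Bigg[\sum_{\substack{\sigma\in BNC(\alpha)\\ \pi\le\sigma\le\epsilon}}\mu_{BNC}(\pi,\sigma)\Bigg]\varphi_\pi(z^\epsilon).$$ -/

import Mathlib

open scoped TensorProduct

noncomputable section

namespace BiFree

/-! ### Partitions, non-crossing and bi-non-crossing partitions -/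

/-- Partitions of the `n`-element set `Fin n`, ordered by refinement. -/
abbrev Part (n : ℕ) : Type := Finpartition (Finset.univ : Finset (Fin n))

/-- The action of a permutation on partitions: the blocks of `s • π` are the images `s(V)`
of the blocks `V` of `π`. -/
def permPart {n : ℕ} (s : Equiv.Perm (Fin n)) (π : Part n) : Part n :=
  Finpartition.ofExistsUnique (π.parts.map s.finsetCongr.toEmbedding)
    (fun _ _ => Finset.subset_univ _)
    (by
      intro a _
      obtain ⟨V, ⟨hV, ha⟩, huniq⟩ := π.existsUnique_mem (Finset.mem_univ (s.symm a))
      refine ⟨V.map s.toEmbedding, ⟨Finset.mem_map.2 ⟨V, hV, rfl⟩, ?_⟩, ?_⟩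
      · exact Finset.mem_map.2 ⟨s.symm a, ha, by simp⟩
      · rintro W ⟨hW, haW⟩
        obtain ⟨U, hU, rfl⟩ := Finset.mem_map.1 hW
        have haU : s.symm a ∈ U := by
          obtain ⟨b, hb, hba⟩ := Finset.mem_map.1 haW
          have : s.symm a = b := by rw [← hba]; simp
          rwa [this]
        rw [huniq U ⟨hU, haU⟩]
        rfl)
    (by
      intro h
      obtain ⟨V, hV, h0⟩ := Finset.mem_map.1 h
      have : V = ∅ := Finset.map_eq_empty.1 h0
      subst this
      exact π.bot_notMem hV)

/-- Non-crossing partitions: there are no `a < b < c < d` with `a, c` in one block and `b, d` in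
a different block. -/
def IsNonCrossing {n : ℕ} (π : Part n) : Prop :=
  ∀ V ∈ π.parts, ∀ W ∈ π.parts, V ≠ W →
    ∀ a b c d : Fin n, a < b → b < c → c < d → a ∈ V → c ∈ V → b ∈ W → d ∉ W

/-- The positions `k` at which `α` takes a value in the left index set `I`. -/
def leftPositions {I J : Type*} {n : ℕ} (α : Fin n → I ⊕ J) : Finset (Fin n) :=
  Finset.univ.filter fun k => (α k).isLeft = true

/-- The permutation `s_α`: it lists the left positions in increasing order, followed by the right
positions in decreasing order. -/
def sPerm {I J : Type*} {n : ℕ} (α : Fin n → I ⊕ J) : Equiv.Perm (Fin n) :=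
  (finCongr (by
      rw [Finset.card_add_card_compl, Fintype.card_fin] :
        n = (leftPositions α).card + ((leftPositions α)ᶜ).card)).trans <|
    finSumFinEquiv.symm.trans <|
      (Equiv.sumCongr (Equiv.refl _) Fin.revPerm).trans <|
        finSumEquivOfFinset (s := leftPositions α) rfl rfl

/-- The set `BNC(α)` of bi-non-crossing partitions, as a poset under refinement. -/
abbrev BNC {I J : Type*} {n : ℕ} (α : Fin n → I ⊕ J) : Type :=
  {π : Part n // IsNonCrossing (permPart (sPerm α)⁻¹ π)}

open Classical in
instance {I J : Type*} {n : ℕ} (α : Fin n → I ⊕ J) : Fintype (BNC α) :=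
  inferInstance

open Classical in
instance {I J : Type*} {n : ℕ} (α : Fin n → I ⊕ J) : LocallyFiniteOrder (BNC α) :=
  Fintype.toLocallyFiniteOrder

open Classical in
/-- The Möbius function of the lattice `BNC(α)`. -/
def muBNC {I J : Type*} {n : ℕ} (α : Fin n → I ⊕ J) (π σ : BNC α) : ℂ :=
  IncidenceAlgebra.mu ℂ (α := BNC α) π σ

open Classical in
/-- The partition of `Fin n` induced by a shading `ε`: its blocks are the non-empty fibres
of `ε`. -/
def shadingPart {n : ℕ} (ε : Fin n → Fin 2) : Part n :=
  Finpartition.ofSetoid (Setoid.ker ε)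

/-! ### Moments -/

/-- `φ_π(T₁, …, Tₙ)`: the product over the blocks `{k₁ < ⋯ < kₘ}` of `π` of
`φ(T_{k₁} ⋯ T_{kₘ})`. -/
def momentPart {A : Type*} [Ring A] [Algebra ℂ A] (φ : A →ₗ[ℂ] ℂ) {n : ℕ} (π : Part n)
    (T : Fin n → A) : ℂ :=
  ∏ V ∈ π.parts, φ ((V.sort (· ≤ ·)).map T).prod

/-- The joint distribution of a family `a` in `(A, φ)`: the functional `P ↦ φ(P(a))` on
non-commutative polynomials. -/
def jointDistribution {A K : Type*} [Ring A] [Algebra ℂ A] (φ : A →ₗ[ℂ] ℂ) (a : K → A) :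
    FreeAlgebra ℂ K →ₗ[ℂ] ℂ :=
  φ ∘ₗ (FreeAlgebra.lift ℂ a).toLinearMap

/-- A two-faced family of elements of `A`, with left face indexed by `I` and right face indexed
by `J`. -/
structure TwoFacedFamily (I J A : Type*) where
  left : I → A
  right : J → A

/-- The element `z_k` of a two-faced family, for `k ∈ I ⊔ J`. -/
def TwoFacedFamily.elem {I J A : Type*} (z : TwoFacedFamily I J A) : I ⊕ J → A :=
  Sum.elim z.left z.right

/-! ### Vector spaces with specified state-vectors and their free product -/

/-- A vector space `X` with a specified state-vector `ξ` and a linear functional `p` with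
`p ξ = 1`; so `X = ℂ ξ ⊕ X°` with `X° = ker p`, and the projection onto `ℂ ξ` along `X°` is
`x ↦ p x • ξ`. -/
structure PointedSpace where
  carrier : Type*
  [grp : AddCommGroup carrier]
  [mod : Module ℂ carrier]
  p : carrier →ₗ[ℂ] ℂ
  ξ : carrier
  p_ξ : p ξ = 1

attribute [instance] PointedSpace.grp PointedSpace.mod

namespace PointedSpace

/-- The subspace `X° = ker p`. -/
abbrev circ (X : PointedSpace) : Submodule ℂ X.carrier := LinearMap.ker X.p

/-- The projection `x ↦ x - p(x) ξ` of `X` onto `X°`. -/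
def proj (X : PointedSpace) : X.carrier →ₗ[ℂ] X.circ :=
  LinearMap.codRestrict X.circ (LinearMap.id - X.p.smulRight X.ξ)
    (by intro x; simp [X.p_ξ])

lemma proj_coe (X : PointedSpace) (x : X.carrier) : (X.proj x : X.carrier) = x - X.p x • X.ξ := rfl

lemma proj_ξ (X : PointedSpace) : X.proj X.ξ = 0 := by
  apply Subtype.ext; simp [proj_coe, X.p_ξ]

lemma proj_circ (X : PointedSpace) (x : X.circ) : X.proj x = x := by
  apply Subtype.ext
  have : X.p x = 0 := x.2
  simp [proj_coe, this]

/-- The state `T ↦ p(T ξ)` on the algebra `L(X)` of all linear operators of `X`. -/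
def state (X : PointedSpace) : Module.End ℂ X.carrier →ₗ[ℂ] ℂ :=
  X.p ∘ₗ LinearMap.applyₗ X.ξ

end PointedSpace

section FreeProduct

variable {ι : Type} [DecidableEq ι] (X : ι → PointedSpace)

/-- The ambient tensor algebra of `⨁ i, X i°`. It is the direct sum over all words
`i₁ ⋯ iₙ` of `X_{i₁}° ⊗ ⋯ ⊗ X_{iₙ}°`, the product being concatenation of tensors. -/
abbrev Tens : Type _ := TensorAlgebra ℂ (DirectSum ι fun i => (X i).circ)

/-- The elementary tensor `x` of length one, `x ∈ X i°`. -/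
def letter (i : ι) : (X i).circ →ₗ[ℂ] Tens X :=
  TensorAlgebra.ι ℂ ∘ₗ DirectSum.lof ℂ ι (fun i => (X i).circ) i

/-- The elementary tensor `x₁ ⊗ ⋯ ⊗ xₙ`, with `xₖ ∈ X_{iₖ}°`; it is `1` for `n = 0`. -/
def monomial (w : List (Σ i, (X i).circ)) : Tens X :=
  (w.map fun x => letter X x.1 x.2).prod

/-- Alternating words: neighbouring letters come from different spaces. -/
def Alternating (w : List (Σ i, (X i).circ)) : Prop :=
  w.IsChain fun x y => x.1 ≠ y.1

/-- `ℂ ⊕ ⨁_{n ≥ 1} ⨁_{i₁ ≠ i₂ ≠ ⋯ ≠ iₙ} X_{i₁}° ⊗ ⋯ ⊗ X_{iₙ}°`. -/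
def freeSub : Submodule ℂ (Tens X) :=
  Submodule.span ℂ (monomial X '' {w | Alternating X w})

/-- `X(ℓ, i) = ℂ ⊕ ⨁_{n ≥ 1} ⨁_{i₁ ≠ ⋯ ≠ iₙ, i₁ ≠ i} X_{i₁}° ⊗ ⋯ ⊗ X_{iₙ}°`. -/
def leftSub (i : ι) : Submodule ℂ (Tens X) :=
  Submodule.span ℂ (monomial X '' {w | Alternating X w ∧ ∀ x ∈ w.head?, x.1 ≠ i})

/-- `X(r, i) = ℂ ⊕ ⨁_{n ≥ 1} ⨁_{i₁ ≠ ⋯ ≠ iₙ, iₙ ≠ i} X_{i₁}° ⊗ ⋯ ⊗ X_{iₙ}°`. -/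
def rightSub (i : ι) : Submodule ℂ (Tens X) :=
  Submodule.span ℂ (monomial X '' {w | Alternating X w ∧ ∀ x ∈ w.getLast?, x.1 ≠ i})

/-- The free product of vector spaces with specified state-vectors: its vector is the empty
tensor word `1`, and its functional takes the coefficient of the empty tensor word. -/
def freeProduct : PointedSpace where
  carrier := freeSub X
  p := (TensorAlgebra.algebraMapInv (R := ℂ)).toLinearMap ∘ₗ (freeSub X).subtype
  ξ := ⟨1, Submodule.subset_span ⟨[], List.isChain_nil, rfl⟩⟩
  p_ξ := by simp

/-- The map `X i = ℂ ξ ⊕ X i° → Tens X` that sends `ξ` to `1` and is the inclusion on `X i°`. -/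
def embed (i : ι) : (X i).carrier →ₗ[ℂ] Tens X :=
  (X i).p.smulRight 1 + letter X i ∘ₗ (X i).proj

lemma embed_apply (i : ι) (x : (X i).carrier) :
    embed X i x = (X i).p x • 1 + letter X i ((X i).proj x) := rfl

lemma embed_ξ (i : ι) : embed X i (X i).ξ = 1 := by
  simp [embed_apply, (X i).p_ξ, (X i).proj_ξ]

lemma embed_circ (i : ι) (x : (X i).circ) : embed X i x = letter X i x := by
  have : (X i).p x = 0 := x.2
  simp [embed_apply, (X i).proj_circ, this]

lemma monomial_cons (x : Σ i, (X i).circ) (w : List (Σ i, (X i).circ)) :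
    monomial X (x :: w) = letter X x.1 x.2 * monomial X w := by
  simp [monomial]

lemma monomial_concat (x : Σ i, (X i).circ) (w : List (Σ i, (X i).circ)) :
    monomial X (w ++ [x]) = monomial X w * letter X x.1 x.2 := by
  simp [monomial]

/-- `x ⊗ w ↦ x w` on `X i ⊗ X(ℓ, i)`. -/
def leftMul (i : ι) : (X i).carrier ⊗[ℂ] leftSub X i →ₗ[ℂ] Tens X :=
  LinearMap.mul' ℂ (Tens X) ∘ₗ TensorProduct.map (embed X i) (leftSub X i).subtype

/-- `w ⊗ x ↦ w x` on `X(r, i) ⊗ X i`. -/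
def rightMul (i : ι) : rightSub X i ⊗[ℂ] (X i).carrier →ₗ[ℂ] Tens X :=
  LinearMap.mul' ℂ (Tens X) ∘ₗ TensorProduct.map (rightSub X i).subtype (embed X i)

lemma leftMul_tmul (i : ι) (x : (X i).carrier) (w : leftSub X i) :
    leftMul X i (x ⊗ₜ w) = embed X i x * w := by simp [leftMul]

lemma rightMul_tmul (i : ι) (x : (X i).carrier) (w : rightSub X i) :
    rightMul X i (w ⊗ₜ x) = w * embed X i x := by simp [rightMul]

lemma leftMul_mem (i : ι) (u : (X i).carrier ⊗[ℂ] leftSub X i) : leftMul X i u ∈ freeSub X := by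
  induction u with
  | zero => simp
  | add a b ha hb => rw [map_add]; exact add_mem ha hb
  | tmul x w =>
    rw [leftMul_tmul]
    obtain ⟨w, hw⟩ := w
    simp only
    induction hw using Submodule.span_induction with
    | zero => simp
    | add a b _ _ ha hb => rw [mul_add]; exact add_mem ha hb
    | smul c a _ ha => rw [mul_smul_comm]; exact Submodule.smul_mem _ _ ha
    | mem a ha =>
      obtain ⟨w, ⟨hw, hh⟩, rfl⟩ := ha
      rw [embed_apply, add_mul, smul_mul_assoc, one_mul]
      refine add_mem (Submodule.smul_mem _ _ (Submodule.subset_span ⟨w, hw, rfl⟩))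
        (Submodule.subset_span ⟨⟨i, (X i).proj x⟩ :: w, ?_, monomial_cons X _ _⟩)
      exact List.isChain_cons.2 ⟨fun y hy => (hh y hy).symm, hw⟩

lemma rightMul_mem (i : ι) (u : rightSub X i ⊗[ℂ] (X i).carrier) :
    rightMul X i u ∈ freeSub X := by
  induction u with
  | zero => simp
  | add a b ha hb => rw [map_add]; exact add_mem ha hb
  | tmul w x =>
    rw [rightMul_tmul]
    obtain ⟨w, hw⟩ := w
    simp only
    induction hw using Submodule.span_induction with
    | zero => simp
    | add a b _ _ ha hb => rw [add_mul]; exact add_mem ha hb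
    | smul c a _ ha => rw [smul_mul_assoc]; exact Submodule.smul_mem _ _ ha
    | mem a ha =>
      obtain ⟨w, ⟨hw, hh⟩, rfl⟩ := ha
      rw [embed_apply, mul_add, mul_smul_comm, mul_one]
      refine add_mem (Submodule.smul_mem _ _ (Submodule.subset_span ⟨w, hw, rfl⟩))
        (Submodule.subset_span ⟨w ++ [⟨i, (X i).proj x⟩], ?_, monomial_concat X _ _⟩)
      refine List.isChain_append.2 ⟨hw, List.isChain_singleton _, ?_⟩
      intro y hy z hz
      simp only [List.head?_cons, Option.mem_some_iff] at hz
      subst hz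
      exact hh y hy

/-- Helper for bijectivity: strip the first letter. -/
lemma exists_strip_left (M : Type*) [AddCommGroup M] [Module ℂ M] :
    ∃ D : TensorAlgebra ℂ M →ₗ[ℂ] M ⊗[ℂ] TensorAlgebra ℂ M,
      D 1 = 0 ∧ ∀ m t, D (TensorAlgebra.ι ℂ m * t) = m ⊗ₜ t := by
  let f : M →ₗ[ℂ] Module.End ℂ (TensorAlgebra ℂ M × (M ⊗[ℂ] TensorAlgebra ℂ M)) :=
    LinearMap.mk₂ ℂ (fun m y => (TensorAlgebra.ι ℂ m * y.1, m ⊗ₜ y.1))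
      (by intros; simp [add_mul, TensorProduct.add_tmul])
      (by intros; simp [TensorProduct.smul_tmul'])
      (by intros; simp [mul_add, TensorProduct.tmul_add])
      (by intros; simp)
  let F := TensorAlgebra.lift ℂ f
  have h3 : ∀ m y, F (TensorAlgebra.ι ℂ m) y = (TensorAlgebra.ι ℂ m * y.1, m ⊗ₜ y.1) := by
    intro m y
    simp only [F, TensorAlgebra.lift_ι_apply]
    rfl
  have h1 : ∀ t y, (F t y).1 = t * y.1 := by
    intro t
    induction t using TensorAlgebra.induction with
    | algebraMap r => intro y; rw [AlgHom.commutes]; simp [Algebra.smul_def, Module.algebraMap_end_apply]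
    | ι m => intro y; rw [h3]
    | mul a b ha hb => intro y; simp [ha, hb, mul_assoc]
    | add a b ha hb => intro y; simp [ha, hb, add_mul]
  refine ⟨LinearMap.snd ℂ _ _ ∘ₗ LinearMap.applyₗ ((1, 0) : TensorAlgebra ℂ M × (M ⊗[ℂ] TensorAlgebra ℂ M)) ∘ₗ F.toLinearMap,
    by simp, ?_⟩
  intro m t
  have h2 : (F t (1, 0)).1 = t := by simp [h1]
  simp [h3, h2]

/-- Helper for bijectivity: strip the last letter. -/
lemma exists_strip_right (M : Type*) [AddCommGroup M] [Module ℂ M] :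
    ∃ D : TensorAlgebra ℂ M →ₗ[ℂ] TensorAlgebra ℂ M ⊗[ℂ] M,
      D 1 = 0 ∧ ∀ m t, D (t * TensorAlgebra.ι ℂ m) = t ⊗ₜ m := by
  let f : M →ₗ[ℂ] Module.End ℂ (TensorAlgebra ℂ M × (TensorAlgebra ℂ M ⊗[ℂ] M)) :=
    LinearMap.mk₂ ℂ (fun m y => (y.1 * TensorAlgebra.ι ℂ m, y.1 ⊗ₜ m))
      (by intros; simp [mul_add, TensorProduct.tmul_add])
      (by intros; simp)
      (by intros; simp [add_mul, TensorProduct.add_tmul])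
      (by intros; simp [TensorProduct.smul_tmul'])
  let F : TensorAlgebra ℂ M →ₐ[ℂ] (Module.End ℂ (TensorAlgebra ℂ M × (TensorAlgebra ℂ M ⊗[ℂ] M)))ᵐᵒᵖ :=
    TensorAlgebra.lift ℂ ((MulOpposite.opLinearEquiv ℂ).toLinearMap ∘ₗ f)
  have h3 : ∀ m y,
      (F (TensorAlgebra.ι ℂ m)).unop y = (y.1 * TensorAlgebra.ι ℂ m, y.1 ⊗ₜ m) := by
    intro m y
    simp only [F, TensorAlgebra.lift_ι_apply]
    rfl
  have h1 : ∀ t y, ((F t).unop y).1 = y.1 * t := by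
    intro t
    induction t using TensorAlgebra.induction with
    | algebraMap r =>
      intro y
      rw [AlgHom.commutes, MulOpposite.algebraMap_apply, MulOpposite.unop_op,
        Module.algebraMap_end_apply, Prod.smul_fst, Algebra.smul_def, Algebra.commutes]
    | ι m => intro y; rw [h3]
    | mul a b ha hb => intro y; simp [ha, hb, mul_assoc]
    | add a b ha hb => intro y; simp [ha, hb, mul_add]
  refine ⟨LinearMap.snd ℂ _ _ ∘ₗ LinearMap.applyₗ ((1, 0) : TensorAlgebra ℂ M × (TensorAlgebra ℂ M ⊗[ℂ] M)) ∘ₗ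
    (MulOpposite.opLinearEquiv ℂ).symm.toLinearMap ∘ₗ F.toLinearMap, by simp, ?_⟩
  intro m t
  have h2 : ((F t).unop (1, 0)).1 = t := by simp [h1]
  simp [h3, h2]

lemma leftMul_injective (i : ι) : Function.Injective (leftMul X i) := by
  obtain ⟨D, hD1, hD⟩ := exists_strip_left (DirectSum ι fun i => (X i).circ)
  let E : Tens X →ₗ[ℂ] (X i).circ ⊗[ℂ] Tens X :=
    LinearMap.rTensor _ (DirectSum.component ℂ ι (fun i => (X i).circ) i) ∘ₗ D
  have hE0 : ∀ w ∈ leftSub X i, E w = 0 := by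
    intro w hw
    induction hw using Submodule.span_induction with
    | zero => simp
    | add a b _ _ ha hb => simp [ha, hb]
    | smul c a _ ha => simp [ha]
    | mem a ha =>
      obtain ⟨w, ⟨_, hh⟩, rfl⟩ := ha
      cases w with
      | nil => simp [E, monomial, hD1]
      | cons x w =>
        have hx : x.1 ≠ i := hh x (by simp)
        rw [monomial_cons]
        simp only [E, letter, LinearMap.comp_apply, hD, LinearMap.rTensor_tmul]
        rw [DirectSum.component.of, dif_neg hx, TensorProduct.zero_tmul]
  have hE : E ∘ₗ leftMul X i = TensorProduct.map (X i).proj (leftSub X i).subtype := by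
    apply TensorProduct.ext'
    intro x w
    rw [LinearMap.comp_apply, leftMul_tmul, embed_apply, add_mul, smul_mul_assoc, one_mul, map_add,
      map_smul, hE0 _ w.2, smul_zero, zero_add]
    simp [E, letter, hD, DirectSum.component.lof_self]
  rw [injective_iff_map_eq_zero]
  intro u hu
  have h1 : TensorProduct.map (X i).proj (leftSub X i).subtype u = 0 := by
    rw [← hE, LinearMap.comp_apply, hu, map_zero]
  have h2 : LinearMap.rTensor _ (X i).proj u = 0 := by
    apply Module.Flat.lTensor_preserves_injective_linearMap (M := (X i).circ)
      (leftSub X i).subtype (Submodule.subtype_injective _)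
    rw [map_zero, ← h1, ← LinearMap.comp_apply, LinearMap.lTensor_comp_rTensor]
  have h3 : (leftMul X i) = (leftSub X i).subtype ∘ₗ (TensorProduct.lid ℂ _).toLinearMap ∘ₗ
      LinearMap.rTensor _ (X i).p + (LinearMap.mul' ℂ (Tens X) ∘ₗ
        TensorProduct.map (letter X i) (leftSub X i).subtype) ∘ₗ
        LinearMap.rTensor _ (X i).proj := by
    apply TensorProduct.ext'
    intro x w
    simp [leftMul_tmul, embed_apply, add_mul]
  have h4 : LinearMap.rTensor (leftSub X i) (X i).p u = 0 := by
    have : leftMul X i u = 0 := hu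
    rw [h3] at this
    simp only [LinearMap.add_apply, LinearMap.comp_apply, h2, map_zero, add_zero] at this
    have h5 := Submodule.subtype_injective _ (this.trans (map_zero (leftSub X i).subtype).symm)
    exact (TensorProduct.lid ℂ _).injective (by simpa using h5)
  have h6 : (LinearMap.id : (X i).carrier ⊗[ℂ] leftSub X i →ₗ[ℂ] _) =
      LinearMap.rTensor _ ((LinearMap.toSpanSingleton ℂ _ (X i).ξ)) ∘ₗ LinearMap.rTensor _ (X i).p +
      LinearMap.rTensor _ (X i).circ.subtype ∘ₗ LinearMap.rTensor _ (X i).proj := by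
    apply TensorProduct.ext'
    intro x w
    simp [PointedSpace.proj_coe, ← TensorProduct.add_tmul]
  have := LinearMap.congr_fun h6 u
  simpa [h2, h4] using this

lemma rightMul_injective (i : ι) : Function.Injective (rightMul X i) := by
  obtain ⟨D, hD1, hD⟩ := exists_strip_right (DirectSum ι fun i => (X i).circ)
  let E : Tens X →ₗ[ℂ] Tens X ⊗[ℂ] (X i).circ :=
    LinearMap.lTensor _ (DirectSum.component ℂ ι (fun i => (X i).circ) i) ∘ₗ D
  have hE0 : ∀ w ∈ rightSub X i, E w = 0 := by
    intro w hw
    induction hw using Submodule.span_induction with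
    | zero => simp
    | add a b _ _ ha hb => simp [ha, hb]
    | smul c a _ ha => simp [ha]
    | mem a ha =>
      obtain ⟨w, ⟨_, hh⟩, rfl⟩ := ha
      rcases List.eq_nil_or_concat' w with rfl | ⟨w, x, rfl⟩
      · simp [E, monomial, hD1]
      · have hx : x.1 ≠ i := hh x (by simp)
        rw [monomial_concat]
        simp only [E, letter, LinearMap.comp_apply, hD, LinearMap.lTensor_tmul]
        rw [DirectSum.component.of, dif_neg hx, TensorProduct.tmul_zero]
  have hE : E ∘ₗ rightMul X i = TensorProduct.map (rightSub X i).subtype (X i).proj := by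
    apply TensorProduct.ext'
    intro w x
    rw [LinearMap.comp_apply, rightMul_tmul, embed_apply, mul_add, mul_smul_comm, mul_one, map_add,
      map_smul, hE0 _ w.2, smul_zero, zero_add]
    simp [E, letter, hD, DirectSum.component.lof_self]
  rw [injective_iff_map_eq_zero]
  intro u hu
  have h1 : TensorProduct.map (rightSub X i).subtype (X i).proj u = 0 := by
    rw [← hE, LinearMap.comp_apply, hu, map_zero]
  have h2 : LinearMap.lTensor _ (X i).proj u = 0 := by
    apply Module.Flat.rTensor_preserves_injective_linearMap (M := (X i).circ)
      (rightSub X i).subtype (Submodule.subtype_injective _)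
    rw [map_zero, ← h1, ← LinearMap.comp_apply, LinearMap.rTensor_comp_lTensor]
  have h3 : (rightMul X i) = (rightSub X i).subtype ∘ₗ (TensorProduct.rid ℂ _).toLinearMap ∘ₗ
      LinearMap.lTensor _ (X i).p + (LinearMap.mul' ℂ (Tens X) ∘ₗ
        TensorProduct.map (rightSub X i).subtype (letter X i)) ∘ₗ
        LinearMap.lTensor _ (X i).proj := by
    apply TensorProduct.ext'
    intro w x
    simp [rightMul_tmul, embed_apply, mul_add]
  have h4 : LinearMap.lTensor (rightSub X i) (X i).p u = 0 := by
    have : rightMul X i u = 0 := hu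
    rw [h3] at this
    simp only [LinearMap.add_apply, LinearMap.comp_apply, h2, map_zero, add_zero] at this
    have h5 := Submodule.subtype_injective _ (this.trans (map_zero (rightSub X i).subtype).symm)
    exact (TensorProduct.rid ℂ _).injective (by simpa using h5)
  have h6 : (LinearMap.id : rightSub X i ⊗[ℂ] (X i).carrier →ₗ[ℂ] _) =
      LinearMap.lTensor _ ((LinearMap.toSpanSingleton ℂ _ (X i).ξ)) ∘ₗ LinearMap.lTensor _ (X i).p +
      LinearMap.lTensor _ (X i).circ.subtype ∘ₗ LinearMap.lTensor _ (X i).proj := by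
    apply TensorProduct.ext'
    intro w x
    simp [PointedSpace.proj_coe, -TensorProduct.tmul_smul, ← TensorProduct.tmul_add]
  have := LinearMap.congr_fun h6 u
  simpa [h2, h4] using this

lemma leftMul_surjective (i : ι) : freeSub X ≤ LinearMap.range (leftMul X i) := by
  refine Submodule.span_le.2 ?_
  rintro _ ⟨w, hw, rfl⟩
  by_cases hh : ∀ x ∈ w.head?, x.1 ≠ i
  · exact ⟨(X i).ξ ⊗ₜ ⟨monomial X w, Submodule.subset_span ⟨w, ⟨hw, hh⟩, rfl⟩⟩,
      by simp [leftMul_tmul, embed_ξ]⟩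
  · cases w with
    | nil => simp at hh
    | cons x w =>
      obtain ⟨j, x⟩ := x
      have hj : j = i := by simpa using hh
      subst hj
      have hw' := List.isChain_cons.1 hw
      exact ⟨(x : (X j).carrier) ⊗ₜ ⟨monomial X w,
        Submodule.subset_span ⟨w, ⟨hw'.2, fun y hy => (hw'.1 y hy).symm⟩, rfl⟩⟩,
        by simp [leftMul_tmul, embed_circ, monomial_cons]⟩

lemma rightMul_surjective (i : ι) : freeSub X ≤ LinearMap.range (rightMul X i) := by
  refine Submodule.span_le.2 ?_
  rintro _ ⟨w, hw, rfl⟩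
  by_cases hh : ∀ x ∈ w.getLast?, x.1 ≠ i
  · exact ⟨⟨monomial X w, Submodule.subset_span ⟨w, ⟨hw, hh⟩, rfl⟩⟩ ⊗ₜ (X i).ξ,
      by simp [rightMul_tmul, embed_ξ]⟩
  · rcases List.eq_nil_or_concat' w with rfl | ⟨w, x, rfl⟩
    · simp at hh
    · obtain ⟨j, x⟩ := x
      have hj : j = i := by simpa using hh
      subst hj
      have hw' := List.isChain_append.1 hw
      exact ⟨⟨monomial X w,
        Submodule.subset_span ⟨w, ⟨hw'.1, fun y hy => hw'.2.2 y hy ⟨j, x⟩ (by simp)⟩, rfl⟩⟩ ⊗ₜ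
          (x : (X j).carrier),
        by simp [rightMul_tmul, embed_circ, monomial_concat]⟩

/-- The identification `V_i : X i ⊗ X(ℓ, i) ≃ X`, with `ξ ⊗ w ↦ w` and `x ⊗ w ↦ x w` for
`x ∈ X i°`. -/
def leftEquiv (i : ι) : (X i).carrier ⊗[ℂ] leftSub X i ≃ₗ[ℂ] (freeProduct X).carrier :=
  LinearEquiv.ofBijective (LinearMap.codRestrict (freeSub X) (leftMul X i) (leftMul_mem X i))
    ⟨fun _ _ h => leftMul_injective X i (congrArg Subtype.val h), fun y => by
      obtain ⟨u, hu⟩ := leftMul_surjective X i y.2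
      exact ⟨u, Subtype.ext hu⟩⟩

/-- The identification `W_i : X(r, i) ⊗ X i ≃ X`, with `w ⊗ ξ ↦ w` and `w ⊗ x ↦ w x` for
`x ∈ X i°`. -/
def rightEquiv (i : ι) : rightSub X i ⊗[ℂ] (X i).carrier ≃ₗ[ℂ] (freeProduct X).carrier :=
  LinearEquiv.ofBijective (LinearMap.codRestrict (freeSub X) (rightMul X i) (rightMul_mem X i))
    ⟨fun _ _ h => rightMul_injective X i (congrArg Subtype.val h), fun y => by
      obtain ⟨u, hu⟩ := rightMul_surjective X i y.2
      exact ⟨u, Subtype.ext hu⟩⟩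

/-- The left representation `λ_i(T) = V_i (T ⊗ 1) V_i⁻¹` of `L(X i)` on the free product. -/
def leftRep (i : ι) (T : Module.End ℂ (X i).carrier) : Module.End ℂ (freeProduct X).carrier :=
  (leftEquiv X i).conj (LinearMap.rTensor (leftSub X i) T)

/-- The right representation `ρ_i(T) = W_i (1 ⊗ T) W_i⁻¹` of `L(X i)` on the free product. -/
def rightRep (i : ι) (T : Module.End ℂ (X i).carrier) : Module.End ℂ (freeProduct X).carrier :=
  (rightEquiv X i).conj (LinearMap.lTensor (rightSub X i) T)

end FreeProduct

/-! ### Bi-freeness -/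

/-- Bi-free independence of the pair `z 0, z 1` of two-faced families in `(A, φ)`. Here
`Algebra.adjoin ℂ (Set.range (z e).left)` is the unital subalgebra generated by the left face of
`z e`, and similarly for the right face. -/
def IsBiFree.{u, v, w} {I : Type v} {J : Type w} {A : Type u} [Ring A] [Algebra ℂ A]
    (φ : A →ₗ[ℂ] ℂ) (z : Fin 2 → TwoFacedFamily I J A) : Prop :=
  ∃ (X : Fin 2 → PointedSpace.{u})
    (l : ∀ e, Algebra.adjoin ℂ (Set.range (z e).left) →ₐ[ℂ] Module.End ℂ (X e).carrier)
    (r : ∀ e, Algebra.adjoin ℂ (Set.range (z e).right) →ₐ[ℂ] Module.End ℂ (X e).carrier),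
    let T : Fin 2 → TwoFacedFamily I J (Module.End ℂ (freeProduct X).carrier) := fun e =>
      { left := fun i => leftRep X e (l e ⟨(z e).left i, Algebra.subset_adjoin ⟨i, rfl⟩⟩)
        right := fun j => rightRep X e (r e ⟨(z e).right j, Algebra.subset_adjoin ⟨j, rfl⟩⟩) }
    jointDistribution (freeProduct X).state (fun k : Fin 2 × (I ⊕ J) => (T k.1).elem k.2) =
      jointDistribution φ (fun k : Fin 2 × (I ⊕ J) => (z k.1).elem k.2)

end BiFree

end

/-! Fix `α` and `ε`, and order the positions by `s_α⁻¹` (`chiPos`): left positions increasing, then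
right positions decreasing. In `T₁ ⋯ Tₙ ξ` the operator at `k` acts after all later ones, a left
operator on the front of the tensor and a right operator on its back, so this is the order in which
the positions appear along the tensor. Bi-non-crossing means non-crossing in this order, and the
two-sided problem becomes one about intervals of a linear order.

Cut a set of positions into its maximal monochromatic intervals. Expand formally the product of the
centred factors `T_B - ψ(B)`, each term being multiplied in the original order of positions, and
apply it to `ξ`. The result is the alternating tensor of the centred vectors of the intervals
(`toTens_centeredSum`), so its coefficient at `ξ` is zero. Each such relation expresses the moment
of a set through moments of proper subsets, so together they determine all moments
(`eq_of_centeredSum_eq_zero`).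

Sums of products of cumulants over non-crossing partitions with monochromatic blocks obey the same
relations: centring leaves only the partitions for which no interval is a union of blocks
(`centeredSum_ncSum`), and there are none (`exists_isSaturated`). Hence mixed cumulants vanish in
the free product (`state_eq_ncSum`). Möbius inversion (`sum_muBNC_mul`) rewrites this as the moment
formula, which therefore holds in every free product (`state_ofFn_rep`).

The coefficient of `φ_π` is an empty sum unless `π ≤ ε`, so the right-hand side sees only
monochromatic moments (`sum_muBNC_momentPart_congr`). Bi-freeness transports the formula from the
free product to `A`. Conversely, let both faces act on `A` by left multiplication, with state `φ`:
the free product has the same monochromatic moments as `A` and obeys the same formula, hence has the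
same joint distribution. -/

noncomputable section

namespace BiFree

/-! ### Alternating sums over families of intervals -/

section CenteredSum

variable {ι κ M N : Type*} [DecidableEq κ] [AddCommGroup M] [Module ℂ M] [AddCommGroup N]
  [Module ℂ N]

/-- The alternating sum `∑_{F ⊆ L} (-1)^|F| ∏_{B ∈ F} ψ(B) f(R ∪ ⋃_{B ∈ L \ F} B)`. -/
def centeredSum (ψ : ι × Finset κ → ℂ) (f : Finset κ → M) :
    List (ι × Finset κ) → Finset κ → M
  | [], R => f R
  | B :: L, R => centeredSum ψ f L (B.2 ∪ R) - ψ B • centeredSum ψ f L R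

/-- The union of the sets in a list of coloured sets. -/
def support (L : List (ι × Finset κ)) : Finset κ :=
  L.foldr (fun B S => B.2 ∪ S) ∅

@[simp] lemma support_nil : support ([] : List (ι × Finset κ)) = ∅ := rfl

@[simp] lemma support_cons (B : ι × Finset κ) (L : List (ι × Finset κ)) :
    support (B :: L) = B.2 ∪ support L := rfl

@[simp] lemma support_append (L L' : List (ι × Finset κ)) :
    support (L ++ L') = support L ∪ support L' := by
  induction L with
  | nil => simp
  | cons B L ih => simp [ih, Finset.union_assoc]

lemma mem_support {L : List (ι × Finset κ)} {x : κ} : x ∈ support L ↔ ∃ B ∈ L, x ∈ B.2 := by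
  induction L with
  | nil => simp
  | cons B L ih => simp [ih]

/-- The alternating sum does not depend on the order of the list, so the recursion may be run at any
member. The last interval is needed for right operators. -/
lemma centeredSum_append_cons (ψ : ι × Finset κ → ℂ) (f : Finset κ → M) (B : ι × Finset κ)
    (L L' : List (ι × Finset κ)) (R : Finset κ) :
    centeredSum ψ f (L ++ B :: L') R =
      centeredSum ψ f (L ++ L') (B.2 ∪ R) - ψ B • centeredSum ψ f (L ++ L') R := by
  induction L generalizing R with
  | nil => rfl
  | cons C L ih =>
    simp only [List.cons_append, centeredSum, ih, Finset.union_left_comm B.2 C.2 R, smul_sub,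
      smul_comm (ψ B) (ψ C)]
    abel

/-- Centered sums are linear in the function. Allowing `R` and `R'` to differ makes it possible to
pull out an operator whose position lies in `R'` but not in `R`. -/
lemma centeredSum_map (ψ : ι × Finset κ → ℂ) {f : Finset κ → M} {g : Finset κ → N}
    (φ : M →ₗ[ℂ] N) (L : List (ι × Finset κ)) {R R' : Finset κ}
    (h : ∀ U, U ⊆ support L → g (U ∪ R') = φ (f (U ∪ R))) :
    centeredSum ψ g L R' = φ (centeredSum ψ f L R) := by
  induction L generalizing R R' with
  | nil => simpa [centeredSum] using h ∅
  | cons B L ih =>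
    rw [centeredSum, centeredSum, map_sub, map_smul, ih (R := B.2 ∪ R), ih (R := R)]
    · exact fun U hU => h U (hU.trans Finset.subset_union_right)
    · intro U hU
      simpa [Finset.union_assoc] using
        h (U ∪ B.2) (Finset.union_subset (hU.trans Finset.subset_union_right)
          Finset.subset_union_left)

lemma centeredSum_congr (ψ : ι × Finset κ → ℂ) {f g : Finset κ → M} (L : List (ι × Finset κ))
    {R : Finset κ} (h : ∀ U, U ⊆ support L ∪ R → f U = g U) :
    centeredSum ψ f L R = centeredSum ψ g L R :=
  centeredSum_map ψ LinearMap.id L fun _ hU =>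
    h _ (Finset.union_subset_union hU subset_rfl)

end CenteredSum

/-! ### Interval decompositions -/

section Intervals

variable {ι κ β : Type*} [LinearOrder β]

/-- `L` is the list of maximal monochromatic intervals of a finite set, with respect to the
order given by `pos` and the colouring `ε`. -/
structure IsIntervals (pos : κ → β) (ε : κ → ι) (L : List (ι × Finset κ)) : Prop where
  nonempty : ∀ B ∈ L, B.2.Nonempty
  color : ∀ B ∈ L, ∀ x ∈ B.2, ε x = B.1
  lt : L.Pairwise fun B C => ∀ x ∈ B.2, ∀ y ∈ C.2, pos x < pos y
  ne : L.IsChain fun B C => B.1 ≠ C.1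

namespace IsIntervals

variable {pos : κ → β} {ε : κ → ι} {L L' : List (ι × Finset κ)} {B : ι × Finset κ}

lemma nil : IsIntervals pos ε [] :=
  ⟨by simp, by simp, List.Pairwise.nil, List.isChain_nil⟩

lemma left (h : IsIntervals pos ε (L ++ L')) : IsIntervals pos ε L where
  nonempty C hC := h.nonempty C (List.mem_append_left _ hC)
  color C hC := h.color C (List.mem_append_left _ hC)
  lt := (List.pairwise_append.1 h.lt).1
  ne := (List.isChain_append.1 h.ne).1

lemma right (h : IsIntervals pos ε (L ++ L')) : IsIntervals pos ε L' where
  nonempty C hC := h.nonempty C (List.mem_append_right _ hC)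
  color C hC := h.color C (List.mem_append_right _ hC)
  lt := (List.pairwise_append.1 h.lt).2.1
  ne := (List.isChain_append.1 h.ne).2.1

/-- An interval may be replaced by a nonempty subset. -/
lemma shrink (h : IsIntervals pos ε (L ++ B :: L')) {S : Finset κ} (hS : S ⊆ B.2)
    (hne : S.Nonempty) : IsIntervals pos ε (L ++ (B.1, S) :: L') where
  nonempty C hC := by
    simp only [List.mem_append, List.mem_cons] at hC
    rcases hC with hC | rfl | hC
    · exact h.nonempty C (by simp [hC])
    · exact hne
    · exact h.nonempty C (by simp [hC])
  color C hC := by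
    simp only [List.mem_append, List.mem_cons] at hC
    rcases hC with hC | rfl | hC
    · exact h.color C (by simp [hC])
    · exact fun x hx => h.color B (by simp) x (hS hx)
    · exact h.color C (by simp [hC])
  lt := by
    have := h.lt
    simp only [List.pairwise_append, List.pairwise_cons, List.mem_cons] at this ⊢
    refine ⟨this.1, ⟨fun C hC x hx => this.2.1.1 C hC x (hS hx), this.2.1.2⟩, ?_⟩
    rintro C hC D (rfl | hD)
    · exact fun x hx y hy => this.2.2 C hC B (Or.inl rfl) x hx y (hS hy)
    · exact this.2.2 C hC D (Or.inr hD)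
  ne := by
    have := h.ne
    simp only [List.isChain_append, List.isChain_cons, List.head?_cons, Option.mem_some_iff]
      at this ⊢
    refine ⟨this.1, this.2.1, ?_⟩
    rintro C hC D rfl
    exact this.2.2 C hC B rfl

/-- Induction on the cardinality: the element of least `pos` either joins the first interval of the
remaining set, if the colours agree, or forms a new first interval. -/
lemma exists_support_eq [DecidableEq κ] (pos : κ → β) (hpos : Function.Injective pos) (ε : κ → ι)
    (S : Finset κ) : ∃ L, IsIntervals pos ε L ∧ support L = S := by
  induction hn : S.card generalizing S with
  | zero => exact ⟨[], nil, by simp [Finset.card_eq_zero.1 hn]⟩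
  | succ n ih =>
    have hS : S.Nonempty := Finset.card_pos.1 (by omega)
    obtain ⟨k, hk, hmin⟩ := S.exists_min_image pos hS
    obtain ⟨L, hL, hLS⟩ := ih (S.erase k) (by rw [Finset.card_erase_of_mem hk]; omega)
    have hlt : ∀ C ∈ L, ∀ y ∈ C.2, pos k < pos y := by
      intro C hC y hy
      have hy' : y ∈ S.erase k := hLS ▸ mem_support.2 ⟨C, hC, hy⟩
      rw [Finset.mem_erase] at hy'
      exact lt_of_le_of_ne (hmin y hy'.2) fun h => hy'.1 (hpos h).symm
    by_cases hhead : ∀ B ∈ L.head?, ε k ≠ B.1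
    · refine ⟨(ε k, {k}) :: L, ⟨?_, ?_, ?_, ?_⟩, ?_⟩
      · rintro C hC
        rcases List.mem_cons.1 hC with rfl | hC
        · exact Finset.singleton_nonempty k
        · exact hL.nonempty C hC
      · rintro C hC
        rcases List.mem_cons.1 hC with rfl | hC
        · simp
        · exact hL.color C hC
      · exact List.pairwise_cons.2 ⟨by simpa using fun a b hab y hy => hlt (a, b) hab y hy, hL.lt⟩
      · exact List.isChain_cons.2 ⟨fun C hC => hhead C hC, hL.ne⟩
      · rw [support_cons, hLS, ← Finset.insert_eq, Finset.insert_erase hk]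
    · cases L with
      | nil => simp at hhead
      | cons B L =>
        have hB : ε k = B.1 := by simpa using hhead
        refine ⟨(B.1, insert k B.2) :: L, ⟨?_, ?_, ?_, ?_⟩, ?_⟩
        · rintro C hC
          rcases List.mem_cons.1 hC with rfl | hC
          · exact Finset.insert_nonempty _ _
          · exact hL.nonempty C (List.mem_cons_of_mem _ hC)
        · rintro C hC
          rcases List.mem_cons.1 hC with rfl | hC
          · intro x hx
            rcases Finset.mem_insert.1 hx with rfl | hx
            · exact hB
            · exact hL.color B (by simp) x hx
          · exact hL.color C (List.mem_cons_of_mem _ hC)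
        · have := List.pairwise_cons.1 hL.lt
          refine List.pairwise_cons.2 ⟨fun C hC x hx y hy => ?_, this.2⟩
          rcases Finset.mem_insert.1 hx with rfl | hx
          · exact hlt C (List.mem_cons_of_mem _ hC) y hy
          · exact this.1 C hC x hx y hy
        · exact List.isChain_cons.2 (List.isChain_cons.1 hL.ne)
        · rw [support_cons] at hLS ⊢
          rw [Finset.insert_union, hLS, Finset.insert_erase hk]

end IsIntervals

/-- A function of finite sets whose centered sums over interval decompositions vanish is
determined by its value at `∅`. -/
lemma eq_of_centeredSum_eq_zero [DecidableEq κ] {M : Type*} [AddCommGroup M] [Module ℂ M]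
    (pos : κ → β) (hpos : Function.Injective pos) (ε : κ → ι)
    (ψ : ι × Finset κ → ℂ) {f g : Finset κ → M} (h0 : f ∅ = g ∅)
    (hf : ∀ L ≠ [], IsIntervals pos ε L → centeredSum ψ f L ∅ = 0)
    (hg : ∀ L ≠ [], IsIntervals pos ε L → centeredSum ψ g L ∅ = 0) (S : Finset κ) :
    f S = g S := by
  -- If `f` and `g` agree on all proper subsets of `support L ∪ R`, only the top term of the
  -- alternating sum contributes to the difference.
  have key : ∀ (L : List (ι × Finset κ)) (R : Finset κ),
      (∀ B ∈ L, B.2.Nonempty) → (L.Pairwise fun B C => Disjoint B.2 C.2) →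
      (∀ B ∈ L, Disjoint B.2 R) → (∀ U, U ⊂ support L ∪ R → f U = g U) →
      centeredSum ψ f L R - centeredSum ψ g L R = f (support L ∪ R) - g (support L ∪ R) := by
    intro L
    induction L with
    | nil => intro R _ _ _ _; simp [centeredSum]
    | cons B L ih =>
      intro R hne hd hR h
      have hd' := List.pairwise_cons.1 hd
      have hlt : support L ∪ R ⊂ support (B :: L) ∪ R := by
        rw [support_cons, Finset.union_assoc]
        refine Finset.ssubset_iff_subset_ne.2 ⟨Finset.subset_union_right, fun he => ?_⟩
        obtain ⟨x, hx⟩ := hne B (by simp)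
        have hx' : x ∈ support L ∪ R := by rw [he]; exact Finset.mem_union_left _ hx
        rcases Finset.mem_union.1 hx' with hx' | hx'
        · obtain ⟨C, hC, hxC⟩ := mem_support.1 hx'
          exact Finset.disjoint_left.1 (hd'.1 C hC) hx hxC
        · exact Finset.disjoint_left.1 (hR B (by simp)) hx hx'
      have hEq : support L ∪ (B.2 ∪ R) = support (B :: L) ∪ R := by
        rw [support_cons, Finset.union_left_comm, Finset.union_assoc]
      -- The subtracted terms involve only subsets of `support L ∪ R`. This set misses the nonempty
      -- `B.2`, so `f` and `g` agree there and these terms cancel.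
      rw [centeredSum, centeredSum,
        centeredSum_congr ψ (f := f) (g := g) L (R := R) fun U hU => h U (hU.trans_ssubset hlt),
        sub_sub_sub_cancel_right, ih (B.2 ∪ R) (fun C hC => hne C (by simp [hC])) hd'.2
          (fun C hC => Finset.disjoint_union_right.2 ⟨(hd'.1 C hC).symm, hR C (by simp [hC])⟩)
          (by rwa [hEq]), hEq]
  induction S using Finset.strongInduction with
  | H S ih =>
    obtain ⟨L, hL, rfl⟩ := IsIntervals.exists_support_eq pos hpos ε S
    by_cases hnil : L = []
    · subst hnil; simpa using h0
    · have := key L ∅ hL.nonempty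
        (hL.lt.imp fun h => Finset.disjoint_left.2 fun x hx hx' => (h x hx x hx').false)
        (by simp) (by simpa using ih)
      rw [hf L hnil hL, hg L hnil hL, sub_zero, Finset.union_empty] at this
      exact sub_eq_zero.1 this.symm

end Intervals

/-! ### Ordered products -/

section OrderedProd

variable {κ A : Type*} [LinearOrder κ] [Monoid A]

/-- The product `T_{k₁} ⋯ T_{kₘ}` over a finite set `{k₁ < ⋯ < kₘ}`. -/
def orderedProd (T : κ → A) (S : Finset κ) : A :=
  ((S.sort (· ≤ ·)).map T).prod

@[simp] lemma orderedProd_empty (T : κ → A) : orderedProd T ∅ = 1 := by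
  simp [orderedProd]

lemma orderedProd_insert (T : κ → A) {k : κ} {S : Finset κ} (h : ∀ l ∈ S, k < l) :
    orderedProd T (insert k S) = T k * orderedProd T S := by
  rw [orderedProd, Finset.sort_insert _ (fun l hl => (h l hl).le) fun hk => (h k hk).false]
  simp [orderedProd]

end OrderedProd

/-! ### Words in the free product -/

section FreeProduct

variable {ι : Type} [DecidableEq ι] (X : ι → PointedSpace)

/-- The inclusion of the free product into the tensor algebra. -/
def toTens : (freeProduct X).carrier →ₗ[ℂ] Tens X := (freeSub X).subtype

lemma toTens_injective : Function.Injective (toTens X) := Subtype.val_injective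

lemma toTens_ξ : toTens X (freeProduct X).ξ = 1 := rfl

lemma freeProduct_p (y : (freeProduct X).carrier) :
    (freeProduct X).p y = TensorAlgebra.algebraMapInv (toTens X y) := rfl

/-- This computes the left representation without inverting `V_i`: it suffices to exhibit the vector
as a product of an element of `X i` and an element of `X(ℓ, i)`. -/
lemma toTens_leftRep {i : ι} (S : Module.End ℂ (X i).carrier) {y : (freeProduct X).carrier}
    {x : (X i).carrier} {w : Tens X} (hw : w ∈ leftSub X i) (hy : toTens X y = embed X i x * w) :
    toTens X (leftRep X i S y) = embed X i (S x) * w := by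
  have h1 : leftEquiv X i (x ⊗ₜ ⟨w, hw⟩) = y := by
    apply toTens_injective
    rw [hy]
    exact leftMul_tmul X i x ⟨w, hw⟩
  rw [leftRep, LinearEquiv.conj_apply_apply, ← h1, LinearEquiv.symm_apply_apply,
    LinearMap.rTensor_tmul]
  exact leftMul_tmul X i (S x) ⟨w, hw⟩

lemma toTens_rightRep {i : ι} (S : Module.End ℂ (X i).carrier) {y : (freeProduct X).carrier}
    {x : (X i).carrier} {w : Tens X} (hw : w ∈ rightSub X i) (hy : toTens X y = w * embed X i x) :
    toTens X (rightRep X i S y) = w * embed X i (S x) := by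
  have h1 : rightEquiv X i (⟨w, hw⟩ ⊗ₜ x) = y := by
    apply toTens_injective
    rw [hy]
    exact rightMul_tmul X i x ⟨w, hw⟩
  rw [rightRep, LinearEquiv.conj_apply_apply, ← h1, LinearEquiv.symm_apply_apply,
    LinearMap.lTensor_tmul]
  exact rightMul_tmul X i (S x) ⟨w, hw⟩

lemma monomial_append (w w' : List (Σ i, (X i).circ)) :
    monomial X (w ++ w') = monomial X w * monomial X w' := by
  simp [monomial]

lemma algebraMapInv_monomial {w : List (Σ i, (X i).circ)} (hw : w ≠ []) :
    TensorAlgebra.algebraMapInv (R := ℂ) (monomial X w) = 0 := by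
  obtain ⟨x, w, rfl⟩ := List.exists_cons_of_ne_nil hw
  simp [monomial_cons, letter, TensorAlgebra.algebraMapInv]

variable {κ β : Type*} [LinearOrder κ] [LinearOrder β]

/-- The operator at position `k`: it acts from the left or from the right, according to `side`,
through its component of colour `ε k`. -/
def rep (side : κ → Bool) (ε : κ → ι) (S : κ → ∀ i, Module.End ℂ (X i).carrier) (k : κ) :
    Module.End ℂ (freeProduct X).carrier :=
  if side k then leftRep X (ε k) (S k (ε k)) else rightRep X (ε k) (S k (ε k))

/-- The vector `S_{k₁} ⋯ S_{kₘ} ξ` in the space of colour `B.1`, for `B.2 = {k₁ < ⋯ < kₘ}`. -/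
def blockVec (S : κ → ∀ i, Module.End ℂ (X i).carrier) (B : ι × Finset κ) : (X B.1).carrier :=
  orderedProd (fun k => S k B.1) B.2 (X B.1).ξ

/-- The moment of the operators in the block `B`. -/
def blockMoment (S : κ → ∀ i, Module.End ℂ (X i).carrier) (B : ι × Finset κ) : ℂ :=
  (X B.1).state (orderedProd (fun k => S k B.1) B.2)

/-- The centred vector of the block `B`. -/
def blockLetter (S : κ → ∀ i, Module.End ℂ (X i).carrier) (B : ι × Finset κ) : Σ i, (X i).circ :=
  ⟨B.1, (X B.1).proj (blockVec X S B)⟩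

lemma embed_blockVec (S : κ → ∀ i, Module.End ℂ (X i).carrier) (B : ι × Finset κ) :
    embed X B.1 (blockVec X S B) =
      blockMoment X S B • 1 + letter X _ (blockLetter X S B).2 := rfl

variable {X} {pos : κ → β} {side : κ → Bool} {ε : κ → ι}
  {S : κ → ∀ i, Module.End ℂ (X i).carrier}

lemma monomial_mem_leftSub {i : ι} {L : List (ι × Finset κ)}
    (h : L.IsChain fun B C => B.1 ≠ C.1) (hi : ∀ B ∈ L.head?, i ≠ B.1) :
    monomial X (L.map (blockLetter X S)) ∈ leftSub X i := by
  refine Submodule.subset_span ⟨_, ⟨(List.isChain_map _).2 h, ?_⟩, rfl⟩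
  intro x hx
  rw [List.head?_map, Option.mem_map] at hx
  obtain ⟨B, hB, rfl⟩ := hx
  exact (hi B hB).symm

lemma monomial_mem_rightSub {i : ι} {L : List (ι × Finset κ)}
    (h : L.IsChain fun B C => B.1 ≠ C.1) (hi : ∀ B ∈ L.getLast?, B.1 ≠ i) :
    monomial X (L.map (blockLetter X S)) ∈ rightSub X i := by
  refine Submodule.subset_span ⟨_, ⟨(List.isChain_map _).2 h, ?_⟩, rfl⟩
  intro x hx
  rw [List.getLast?_map, Option.mem_map] at hx
  obtain ⟨B, hB, rfl⟩ := hx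
  exact hi B hB

/-- The order `pos` puts a left position before, and a right position after, all later
positions. -/
def Compatible (pos : κ → β) (side : κ → Bool) : Prop :=
  ∀ k l, k < l → if side k then pos k < pos l else pos l < pos k

/-- Peeling off the first position `k` of a block `B`, and applying the operator at `k`. -/
lemma centeredSum_peel {L L' : List (ι × Finset κ)} {B : ι × Finset κ} {k : κ}
    (hB : k ∈ B.2) (hk : ∀ l ∈ support (L ++ B :: L'), k ≤ l)
    (hkL : k ∉ support (L ++ L')) :
    let f := fun U => orderedProd (rep X side ε S) U (freeProduct X).ξ
    centeredSum (blockMoment X S) f (L ++ B :: L') ∅ =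
      rep X side ε S k (centeredSum (blockMoment X S) f (L ++ L') (B.2.erase k)) -
        blockMoment X S B • centeredSum (blockMoment X S) f (L ++ L') ∅ := by
  intro f
  rw [centeredSum_append_cons, Finset.union_empty]
  congr 1
  -- Every set in this sum contains `B.2`, and `k` is its least element, so the operator at `k` is
  -- the leftmost factor of each product and comes out by linearity.
  refine centeredSum_map _ (rep X side ε S k) (L ++ L') fun U hU => ?_
  have h1 : U ∪ B.2 = insert k (U ∪ B.2.erase k) := by
    rw [← Finset.union_insert, Finset.insert_erase hB]
  simp only [f]
  rw [h1, orderedProd_insert]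
  · rfl
  · intro l hl
    have hl' : l ∈ support (L ++ B :: L') ∧ l ≠ k := by
      rcases Finset.mem_union.1 hl with hl | hl
      · refine ⟨?_, fun h => hkL (h ▸ hU hl)⟩
        have := hU hl
        simp only [support_append, support_cons, Finset.mem_union] at this ⊢
        tauto
      · have := Finset.mem_erase.1 hl
        refine ⟨?_, this.1⟩
        simp only [support_append, support_cons, Finset.mem_union]
        exact Or.inr (Or.inl this.2)
    exact lt_of_le_of_ne (hk l hl'.1) hl'.2.symm

omit [DecidableEq ι] in
lemma blockVec_eq {B : ι × Finset κ} {k : κ} (hB : k ∈ B.2) (hk : ∀ l ∈ B.2, k ≤ l) :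
    blockVec X S B = S k B.1 (blockVec X S (B.1, B.2.erase k)) := by
  conv_lhs => rw [blockVec, ← Finset.insert_erase hB]
  rw [orderedProd_insert]
  · rfl
  · intro l hl
    rw [Finset.mem_erase] at hl
    exact lt_of_le_of_ne (hk l hl.2) hl.1.symm

/-- The centered sum of the vectors `T_{k₁} ⋯ T_{kₘ} ξ` is the word of the centred block
vectors. -/
theorem toTens_centeredSum (hpos : Compatible pos side) (L : List (ι × Finset κ))
    (hL : IsIntervals pos ε L) :
    toTens X (centeredSum (blockMoment X S)
      (fun U => orderedProd (rep X side ε S) U (freeProduct X).ξ) L ∅) =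
        monomial X (L.map (blockLetter X S)) := by
  induction hn : (support L).card using Nat.strong_induction_on generalizing L with
  | _ n ih =>
    rcases L with _ | ⟨B₀, L₀⟩
    · simp [centeredSum, toTens_ξ, monomial]
    obtain ⟨k, hkm, hk⟩ := (support (B₀ :: L₀)).exists_min_image id
      (by rw [support_cons]; exact (hL.nonempty B₀ (by simp)).mono Finset.subset_union_left)
    simp only [id] at hk
    -- the vector obtained after removal of `k` from its block
    have step : ∀ (L L' : List (ι × Finset κ)) (B : ι × Finset κ), L ++ B :: L' = B₀ :: L₀ →
        k ∈ B.2 → IsIntervals pos ε (L ++ L') →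
        k ∉ support (L ++ L') ∧
        toTens X (centeredSum (blockMoment X S)
          (fun U => orderedProd (rep X side ε S) U (freeProduct X).ξ) (L ++ L') ∅) =
          monomial X ((L ++ L').map (blockLetter X S)) ∧
        toTens X (centeredSum (blockMoment X S)
          (fun U => orderedProd (rep X side ε S) U (freeProduct X).ξ) (L ++ L') (B.2.erase k)) =
          monomial X (L.map (blockLetter X S)) * embed X B.1 (blockVec X S (B.1, B.2.erase k)) *
            monomial X (L'.map (blockLetter X S)) := by
      intro L L' B hLB hkB hLL
      rw [← hLB] at hL hn hk
      have hkn : k ∉ support (L ++ L') := by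
        intro hk'
        obtain ⟨C, hC, hkC⟩ := mem_support.1 hk'
        have := hL.lt
        rw [List.pairwise_append, List.pairwise_cons] at this
        rcases List.mem_append.1 hC with hC | hC
        · exact (this.2.2 C hC B (by simp) k hkC k hkB).false
        · exact (this.2.1.1 C hC k hkB k hkC).false
      have hcard : (support (L ++ L')).card < n := by
        rw [← hn]
        refine Finset.card_lt_card (Finset.ssubset_iff_of_subset ?_ |>.2 ⟨k, ?_, hkn⟩)
        · simp only [support_append, support_cons]
          exact Finset.union_subset_union subset_rfl Finset.subset_union_right
        · simp [hkB]
      have h1 := ih _ hcard (L ++ L') hLL rfl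
      refine ⟨hkn, h1, ?_⟩
      -- If `B.2 = {k}`, the remaining vector is `ξ`, which `embed` sends to `1`: the block
      -- disappears from the word. This is why `L ++ L'` must itself have alternating colours, as it
      -- does when `B` is first or last.
      by_cases hemp : B.2.erase k = ∅
      · rw [hemp, h1]
        simp [blockVec, embed_ξ, monomial]
      · have hne := Finset.nonempty_iff_ne_empty.2 hemp
        have hL' := hL.shrink (Finset.erase_subset k B.2) hne
        have hcard' : (support (L ++ (B.1, B.2.erase k) :: L')).card < n := by
          rw [← hn]
          refine Finset.card_lt_card (Finset.ssubset_iff_of_subset ?_ |>.2 ⟨k, ?_, ?_⟩)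
          · simp only [support_append, support_cons]
            exact Finset.union_subset_union subset_rfl
              (Finset.union_subset_union (Finset.erase_subset _ _) subset_rfl)
          · simp [hkB]
          · simp only [support_append, Finset.mem_union] at hkn
            simp only [support_append, support_cons, Finset.mem_union, Finset.mem_erase]
            tauto
        have h2 := ih _ hcard' _ hL' rfl
        -- Induction gives the word with the centred vector of `B.2.erase k`. Adding back the
        -- subtracted multiple of the word without this block replaces it by the uncentred vector.
        rw [centeredSum_append_cons, Finset.union_empty, map_sub, map_smul, h1,
          sub_eq_iff_eq_add] at h2
        have h3 := embed_blockVec X S (B.1, B.2.erase k)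
        dsimp only at h3
        rw [h2, h3]
        rw [List.map_append, List.map_append, List.map_cons, monomial_append, monomial_append,
          monomial_cons, mul_add, add_mul, mul_smul_comm, mul_one, smul_mul_assoc, mul_assoc,
          add_comm]
    by_cases hside : side k
    -- A left position that precedes all others is also least for `pos`, so it lies in the first
    -- interval. In the right case below it is greatest for `pos` and lies in the last one.
    · have hkB : k ∈ B₀.2 := by
        obtain ⟨C, hC, hkC⟩ := mem_support.1 hkm
        rcases List.mem_cons.1 hC with rfl | hC
        · exact hkC
        · obtain ⟨x, hx⟩ := hL.nonempty B₀ (by simp)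
          have h1 := (List.pairwise_cons.1 hL.lt).1 C hC x hx k hkC
          have hkx : k ≤ x := hk x (mem_support.2 ⟨B₀, by simp, hx⟩)
          rcases hkx.lt_or_eq with hkx | rfl
          · have h2 := hpos k x hkx
            rw [if_pos hside] at h2
            exact (h1.trans h2).false.elim
          · exact hx
      have hchain := List.isChain_cons.1 hL.ne
      obtain ⟨hkn, h1, h2⟩ := step [] L₀ B₀ rfl hkB (hL.right (L := [B₀]))
      have hp := centeredSum_peel (X := X) (side := side) (ε := ε) (S := S) (L := [])
        (L' := L₀) hkB hk hkn
      simp only [List.nil_append, List.map_nil] at hp h1 h2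
      have hcol : ε k = B₀.1 := hL.color B₀ (by simp) k hkB
      have hrep : rep X side ε S k = leftRep X B₀.1 (S k B₀.1) := by
        rw [rep, if_pos hside, hcol]
      -- The rest of the word does not start with the colour of `B₀`, so the operator acts only on
      -- the vector of `B₀` and completes it to `blockVec X S B₀`. The term subtracted in `hp` then
      -- removes its component along `ξ`.
      rw [hp, map_sub, map_smul, hrep, toTens_leftRep X (S k B₀.1)
        (x := blockVec X S (B₀.1, B₀.2.erase k)) (monomial_mem_leftSub (S := S) hchain.2 hchain.1) (by rw [h2]; simp [monomial]), h1,
        ← blockVec_eq hkB fun l hl => hk l (mem_support.2 ⟨B₀, by simp, hl⟩), embed_blockVec,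
        List.map_cons, monomial_cons]
      simp [add_mul, blockLetter]
    · obtain ⟨L₁, B, hLB⟩ : ∃ L₁ B, L₁ ++ [B] = B₀ :: L₀ :=
        ⟨_, _, List.dropLast_append_getLast (List.cons_ne_nil B₀ L₀)⟩
      rw [← hLB] at hL hkm hk ⊢
      have hkB : k ∈ B.2 := by
        obtain ⟨C, hC, hkC⟩ := mem_support.1 hkm
        rcases List.mem_append.1 hC with hC | hC
        · obtain ⟨x, hx⟩ := hL.nonempty B (by simp)
          have h1 := (List.pairwise_append.1 hL.lt).2.2 C hC B (by simp) k hkC x hx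
          have hkx : k ≤ x := hk x (mem_support.2 ⟨B, by simp, hx⟩)
          rcases hkx.lt_or_eq with hkx | rfl
          · have h2 := hpos k x hkx
            rw [if_neg hside] at h2
            exact (h1.trans h2).false.elim
          · exact hx
        · rw [List.mem_singleton] at hC
          rwa [← hC]
      have hchain := List.isChain_append.1 hL.ne
      obtain ⟨hkn, h1, h2⟩ := step L₁ [] B hLB hkB (by simpa using hL.left)
      have hp := centeredSum_peel (X := X) (side := side) (ε := ε) (S := S) (L := L₁)
        (L' := []) hkB hk hkn
      simp only [List.append_nil, List.map_nil] at hp h1 h2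
      have hcol : ε k = B.1 := hL.color B (by simp) k hkB
      have hrep : rep X side ε S k = rightRep X B.1 (S k B.1) := by
        rw [rep, if_neg hside, hcol]
      rw [hp, map_sub, map_smul, hrep, toTens_rightRep X (S k B.1)
        (x := blockVec X S (B.1, B.2.erase k)) (monomial_mem_rightSub (S := S) hchain.1 fun C hC => hchain.2.2 C hC B (by simp))
        (by rw [h2]; simp [monomial]), h1,
        ← blockVec_eq hkB fun l hl => hk l (mem_support.2 ⟨B, by simp, hl⟩), embed_blockVec,
        List.map_append, List.map_singleton, monomial_concat]
      simp [mul_add, blockLetter]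

/-- The centered sums of moments in the free product vanish. -/
theorem centeredSum_moment_eq_zero (hpos : Compatible pos side) {L : List (ι × Finset κ)}
    (hne : L ≠ []) (hL : IsIntervals pos ε L) :
    centeredSum (blockMoment X S)
      (fun U => (freeProduct X).state (orderedProd (rep X side ε S) U)) L ∅ = 0 := by
  rw [centeredSum_map (blockMoment X S) (freeProduct X).p L (R := ∅)
    (f := fun U => orderedProd (rep X side ε S) U (freeProduct X).ξ) fun U _ => rfl,
    freeProduct_p, toTens_centeredSum hpos L hL, algebraMapInv_monomial X (by simpa using hne)]

/-- On monochromatic sets the moments in the free product are those of the factors. -/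
lemma state_orderedProd_rep (hpos : Compatible pos side) {B : ι × Finset κ}
    (hB : ∀ x ∈ B.2, ε x = B.1) :
    (freeProduct X).state (orderedProd (rep X side ε S) B.2) = blockMoment X S B := by
  rcases B.2.eq_empty_or_nonempty with hemp | hne
  · have h1 (Y : PointedSpace) : Y.state 1 = 1 := Y.p_ξ
    rw [blockMoment, hemp, orderedProd_empty, orderedProd_empty, h1, h1]
  -- A nonempty monochromatic set is a single interval, and its vanishing centered sum is the
  -- difference of the two sides.
  · have hL : IsIntervals pos ε [B] :=
      ⟨by simpa using hne, by simpa using hB, by simp, by simp⟩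
    have := centeredSum_moment_eq_zero (X := X) (S := S) hpos (by simp) hL
    simp only [centeredSum, Finset.union_empty, orderedProd_empty, smul_eq_mul] at this
    have h1 : (freeProduct X).state 1 = 1 := (freeProduct X).p_ξ
    rwa [h1, mul_one, sub_eq_zero] at this

end FreeProduct

/-! ### Sums over non-crossing partitions of finite sets -/

section NonCrossing

variable {ι κ β : Type*} [LinearOrder β]

/-- `P` is the set of blocks of a partition of the finite set `S`. -/
structure IsPart (P : Finset (Finset κ)) (S : Finset κ) : Prop where
  nonempty : ∀ V ∈ P, V.Nonempty
  eq_of_mem : ∀ V ∈ P, ∀ W ∈ P, ∀ x ∈ V, x ∈ W → V = W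
  mem_iff : ∀ x, x ∈ S ↔ ∃ V ∈ P, x ∈ V

lemma IsPart.subset {P : Finset (Finset κ)} {S : Finset κ} (h : IsPart P S) {V : Finset κ}
    (hV : V ∈ P) : V ⊆ S := fun x hx => (h.mem_iff x).2 ⟨V, hV, hx⟩

/-- Two sets cross with respect to the order given by `pos`. -/
def Crossing (pos : κ → β) (V W : Finset κ) : Prop :=
  ∃ a ∈ V, ∃ b ∈ W, ∃ c ∈ V, ∃ d ∈ W, pos a < pos b ∧ pos b < pos c ∧ pos c < pos d

lemma Crossing.mono {pos : κ → β} {V W V' W' : Finset κ} (h : Crossing pos V W) (hV : V ⊆ V')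
    (hW : W ⊆ W') : Crossing pos V' W' := by
  obtain ⟨a, ha, b, hb, c, hc, d, hd, h⟩ := h
  exact ⟨a, hV ha, b, hW hb, c, hV hc, d, hW hd, h⟩

variable [DecidableEq κ]

open Classical in
/-- The non-crossing partitions of a finite set, as sets of blocks. -/
def ncParts (pos : κ → β) (S : Finset κ) : Finset (Finset (Finset κ)) :=
  S.powerset.powerset.filter fun P =>
    IsPart P S ∧ ∀ V ∈ P, ∀ W ∈ P, V ≠ W → ¬ Crossing pos V W

lemma mem_ncParts {pos : κ → β} {S : Finset κ} {P : Finset (Finset κ)} :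
    P ∈ ncParts pos S ↔ IsPart P S ∧ ∀ V ∈ P, ∀ W ∈ P, V ≠ W → ¬ Crossing pos V W := by
  simp only [ncParts, Finset.mem_filter, Finset.mem_powerset, and_iff_right_iff_imp]
  exact fun h V hV => Finset.mem_powerset.2 (h.1.subset hV)

lemma ncParts_empty (pos : κ → β) : ncParts pos ∅ = {∅} := by
  ext P
  rw [mem_ncParts, Finset.mem_singleton]
  constructor
  · rintro ⟨h, -⟩
    refine Finset.eq_empty_of_forall_notMem fun V hV => ?_
    obtain ⟨x, hx⟩ := h.nonempty V hV
    simpa using h.subset hV hx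
  · rintro rfl
    exact ⟨⟨by simp, by simp, by simp⟩, by simp⟩

/-- Every block of `P` lies in a member of `τ`. -/
def Refines (P τ : Finset (Finset κ)) : Prop := ∀ V ∈ P, ∃ B ∈ τ, V ⊆ B

open Classical in
/-- Non-crossing partitions that refine `insert B τ` are pairs of non-crossing partitions. -/
lemma sum_ncParts_insert {M : Type*} [AddCommMonoid M] {pos : κ → β} {B S S' : Finset κ}
    {τ : Finset (Finset κ)} (hS : S = B ∪ S') (hd : Disjoint B S') (hτ : ∀ C ∈ τ, C ⊆ S')
    (hcr : ∀ C ∈ τ, ¬ Crossing pos B C ∧ ¬ Crossing pos C B)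
    (G : Finset (Finset κ) → Finset (Finset κ) → M) :
    ∑ P ∈ ncParts pos S with Refines P (insert B τ),
        G (P.filter (· ⊆ B)) (P.filter fun V => ¬ V ⊆ B) =
      ∑ P₁ ∈ ncParts pos B, ∑ P₂ ∈ ncParts pos S' with Refines P₂ τ, G P₁ P₂ := by
  subst hS
  have hBS : ∀ x, x ∈ B → x ∈ S' → False := fun x hx hx' => Finset.disjoint_left.1 hd hx hx'
  rw [← Finset.sum_product']
  refine Finset.sum_nbij' (fun P => (P.filter (· ⊆ B), P.filter fun V => ¬ V ⊆ B))
    (fun p => p.1 ∪ p.2) ?_ ?_ ?_ ?_ ?_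
  · intro P hP
    simp only [Finset.mem_filter, mem_ncParts] at hP
    obtain ⟨⟨hP, hnc⟩, href⟩ := hP
    have hcase : ∀ V ∈ P, V ⊆ B ∨ ∃ C ∈ τ, V ⊆ C := fun V hV => by
      obtain ⟨C, hC, hVC⟩ := href V hV
      rcases Finset.mem_insert.1 hC with rfl | hC
      exacts [Or.inl hVC, Or.inr ⟨C, hC, hVC⟩]
    simp only [Finset.mem_product, Finset.mem_filter, mem_ncParts]
    refine ⟨⟨⟨?_, ?_, ?_⟩, ?_⟩, ⟨⟨?_, ?_, ?_⟩, ?_⟩, ?_⟩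
    · exact fun V hV => hP.nonempty V (Finset.mem_filter.1 hV).1
    · exact fun V hV W hW =>
        hP.eq_of_mem V (Finset.mem_of_mem_filter V hV) W (Finset.mem_of_mem_filter W hW)
    · intro x
      refine ⟨fun hx => ?_, fun ⟨V, hV, hx⟩ => (Finset.mem_filter.1 hV).2 hx⟩
      obtain ⟨V, hV, hxV⟩ := (hP.mem_iff x).1 (Finset.mem_union_left _ hx)
      rcases hcase V hV with h | ⟨C, hC, h⟩
      · exact ⟨V, Finset.mem_filter.2 ⟨hV, h⟩, hxV⟩
      · exact (hBS x hx (hτ C hC (h hxV))).elim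
    · exact fun V hV W hW => hnc V hV.1 W hW.1
    · exact fun V hV => hP.nonempty V (Finset.mem_filter.1 hV).1
    · exact fun V hV W hW =>
        hP.eq_of_mem V (Finset.mem_of_mem_filter V hV) W (Finset.mem_of_mem_filter W hW)
    · intro x
      constructor
      · intro hx
        obtain ⟨V, hV, hxV⟩ := (hP.mem_iff x).1 (Finset.mem_union_right _ hx)
        exact ⟨V, Finset.mem_filter.2 ⟨hV, fun h => hBS x (h hxV) hx⟩, hxV⟩
      · rintro ⟨V, hV, hxV⟩
        rw [Finset.mem_filter] at hV
        obtain ⟨C, hC, h⟩ := (hcase V hV.1).resolve_left hV.2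
        exact hτ C hC (h hxV)
    · exact fun V hV W hW => hnc V hV.1 W hW.1
    · intro V hV
      rw [Finset.mem_filter] at hV
      exact (hcase V hV.1).resolve_left hV.2
  · rintro ⟨P₁, P₂⟩ hP
    simp only [Finset.mem_product, Finset.mem_filter, mem_ncParts] at hP
    obtain ⟨⟨h1, hnc1⟩, ⟨h2, hnc2⟩, href⟩ := hP
    simp only [Finset.mem_filter, mem_ncParts]
    refine ⟨⟨⟨?_, ?_, ?_⟩, ?_⟩, ?_⟩
    · intro V hV
      exact (Finset.mem_union.1 hV).elim (h1.nonempty V) (h2.nonempty V)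
    · intro V hV W hW x hxV hxW
      rcases Finset.mem_union.1 hV with hV | hV <;> rcases Finset.mem_union.1 hW with hW | hW
      · exact h1.eq_of_mem V hV W hW x hxV hxW
      · exact (hBS x (h1.subset hV hxV) (h2.subset hW hxW)).elim
      · exact (hBS x (h1.subset hW hxW) (h2.subset hV hxV)).elim
      · exact h2.eq_of_mem V hV W hW x hxV hxW
    · intro x
      rw [Finset.mem_union, h1.mem_iff, h2.mem_iff]
      simp only [Finset.mem_union, or_and_right, exists_or]
    · intro V hV W hW hVW hc
      rcases Finset.mem_union.1 hV with hV | hV <;> rcases Finset.mem_union.1 hW with hW | hW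
      · exact hnc1 V hV W hW hVW hc
      -- Enlarging both blocks to `B` and `C` would give a crossing of `B` with a member of `τ`.
      · obtain ⟨C, hC, h⟩ := href W hW
        exact (hcr C hC).1 (hc.mono (h1.subset hV) h)
      · obtain ⟨C, hC, h⟩ := href V hV
        exact (hcr C hC).2 (hc.mono h (h1.subset hW))
      · exact hnc2 V hV W hW hVW hc
    · intro V hV
      rcases Finset.mem_union.1 hV with hV | hV
      · exact ⟨B, Finset.mem_insert_self _ _, h1.subset hV⟩
      · obtain ⟨C, hC, h⟩ := href V hV
        exact ⟨C, Finset.mem_insert_of_mem hC, h⟩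
  · intro P _
    exact Finset.filter_union_filter_not_eq _ _
  · rintro ⟨P₁, P₂⟩ hP
    simp only [Finset.mem_product, Finset.mem_filter, mem_ncParts] at hP
    obtain ⟨⟨h1, -⟩, ⟨h2, -⟩, -⟩ := hP
    have h1' : ∀ V ∈ P₁, V ⊆ B := fun V hV => h1.subset hV
    have h2' : ∀ V ∈ P₂, ¬ V ⊆ B := fun V hV h => by
      obtain ⟨x, hx⟩ := h2.nonempty V hV
      exact hBS x (h hx) (h2.subset hV hx)
    rw [Prod.mk.injEq, Finset.filter_union, Finset.filter_union, Finset.filter_true_of_mem h1',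
      Finset.filter_false_of_mem h2', Finset.union_empty, Finset.filter_true_of_mem h2',
      Finset.filter_false_of_mem fun V hV h => h (h1' V hV), Finset.empty_union]
    exact ⟨rfl, rfl⟩
  · intro P _
    rfl

/-- The sum over the non-crossing partitions of `S` of the products of `f` over the blocks. -/
def ncSum (pos : κ → β) (f : Finset κ → ℂ) (S : Finset κ) : ℂ :=
  ∑ P ∈ ncParts pos S, ∏ V ∈ P, f V

lemma ncSum_empty (pos : κ → β) (f : Finset κ → ℂ) : ncSum pos f ∅ = 1 := by
  simp [ncSum, ncParts_empty]

open Classical in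
/-- The sum over the non-crossing partitions finer than a non-crossing partition factors. -/
lemma sum_ncParts_refines {pos : κ → β} (f : Finset κ → ℂ) {τ : Finset (Finset κ)} {S : Finset κ}
    (hτ : τ ∈ ncParts pos S) :
    ∑ P ∈ ncParts pos S with Refines P τ, ∏ V ∈ P, f V = ∏ B ∈ τ, ncSum pos f B := by
  induction τ using Finset.induction generalizing S with
  | empty =>
    rw [mem_ncParts] at hτ
    have hS : S = ∅ := Finset.eq_empty_of_forall_notMem fun x hx => by
      simpa using (hτ.1.mem_iff x).1 hx
    rw [hS, ncParts_empty, Finset.filter_true_of_mem (by simp [Refines])]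
    simp
  | insert B τ hB ih =>
    rw [mem_ncParts] at hτ
    obtain ⟨h, hnc⟩ := hτ
    have hmem : ∀ x, x ∈ τ.biUnion id ↔ ∃ V ∈ τ, x ∈ V := by simp
    have hB' : B ∈ insert B τ := Finset.mem_insert_self _ _
    have hsub : ∀ V ∈ τ, V ∈ insert B τ := fun V hV => Finset.mem_insert_of_mem hV
    have hne : ∀ V ∈ τ, B ≠ V := fun V hV h => hB (h ▸ hV)
    have hτ' : τ ∈ ncParts pos (τ.biUnion id) := mem_ncParts.2
      ⟨⟨fun V hV => h.nonempty V (hsub V hV),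
        fun V hV W hW => h.eq_of_mem V (hsub V hV) W (hsub W hW), hmem⟩,
        fun V hV W hW => hnc V (hsub V hV) W (hsub W hW)⟩
    have key := sum_ncParts_insert (pos := pos) (B := B) (S := S) (S' := τ.biUnion id) (τ := τ)
      (by ext x; rw [h.mem_iff, Finset.mem_union, hmem]; simp)
      (Finset.disjoint_left.2 fun x hx hx' => by
        obtain ⟨V, hV, hxV⟩ := (hmem x).1 hx'
        exact hne V hV (h.eq_of_mem B hB' V (hsub V hV) x hx hxV))
      (fun C hC => Finset.subset_biUnion_of_mem id hC)
      (fun C hC => ⟨hnc B hB' C (hsub C hC) (hne C hC), hnc C (hsub C hC) B hB' (hne C hC).symm⟩)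
      (fun P₁ P₂ => (∏ V ∈ P₁, f V) * ∏ V ∈ P₂, f V)
    simp only [Finset.prod_filter_mul_prod_filter_not] at key
    rw [key, Finset.prod_insert hB, ← ih hτ', ncSum, Finset.sum_mul_sum]

/-- The set `J` is a union of blocks of `P`. -/
def IsSaturated (J : Finset κ) (P : Finset (Finset κ)) : Prop :=
  ∀ V ∈ P, V ⊆ J ∨ Disjoint V J

open Classical in
/-- Centered sums of `ncSum` are sums over the non-crossing partitions for which none of the
intervals is a union of blocks. -/
lemma centeredSum_ncSum {pos : κ → β} (f : Finset κ → ℂ) (ψ : ι × Finset κ → ℂ)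
    (L : List (ι × Finset κ)) (R : Finset κ) (hψ : ∀ B ∈ L, ψ B = ncSum pos f B.2)
    (hd : L.Pairwise fun B C => Disjoint B.2 C.2) (hR : ∀ B ∈ L, Disjoint B.2 R)
    (hint : ∀ B ∈ L, ∀ a ∈ B.2, ∀ c ∈ B.2, ∀ b ∈ support L ∪ R, pos a < pos b → pos b < pos c →
      b ∈ B.2) :
    centeredSum ψ (ncSum pos f) L R =
      ∑ P ∈ ncParts pos (support L ∪ R) with ∀ B ∈ L, ¬ IsSaturated B.2 P, ∏ V ∈ P, f V := by
  induction L generalizing R with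
  | nil => simp [centeredSum, ncSum]
  | cons B L ih =>
    have hd' := List.pairwise_cons.1 hd
    have hU : support L ∪ (B.2 ∪ R) = support (B :: L) ∪ R := by
      rw [support_cons, Finset.union_left_comm, Finset.union_assoc]
    have hBd : Disjoint B.2 (support L ∪ R) := by
      refine Finset.disjoint_left.2 fun x hx hx' => ?_
      rcases Finset.mem_union.1 hx' with hx' | hx'
      · obtain ⟨C, hC, hxC⟩ := mem_support.1 hx'
        exact Finset.disjoint_left.1 (hd'.1 C hC) hx hxC
      · exact Finset.disjoint_left.1 (hR B (by simp)) hx hx'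
    have hsub : support L ∪ R ⊆ support (B :: L) ∪ R :=
      Finset.union_subset_union Finset.subset_union_right subset_rfl
    rw [centeredSum, ih (B.2 ∪ R) (fun C hC => hψ C (by simp [hC])) hd'.2
        (fun C hC => Finset.disjoint_union_right.2 ⟨(hd'.1 C hC).symm, hR C (by simp [hC])⟩)
        (by rw [hU]; exact fun C hC => hint C (by simp [hC])),
      ih R (fun C hC => hψ C (by simp [hC])) hd'.2 (fun C hC => hR C (by simp [hC]))
        (fun C hC a ha c hc b hb => hint C (by simp [hC]) a ha c hc b (hsub hb)), hU,
      hψ B (by simp)]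
    -- The partitions for which `B.2` is saturated are those refining `{B.2, support L ∪ R}`. Since
    -- `B.2` is an interval, they are independent pairs of non-crossing partitions, and their sum
    -- has the factor `ncSum pos f B.2 = ψ B`, so it is the term to subtract.
    have key := sum_ncParts_insert (pos := pos) (B := B.2) (S := support (B :: L) ∪ R)
      (S' := support L ∪ R) (τ := {support L ∪ R})
      (by rw [support_cons, Finset.union_assoc]) hBd (by simp)
      (by
        have hB : ∀ x ∈ support L ∪ R, x ∉ B.2 := fun x hx hx' =>
          Finset.disjoint_left.1 hBd hx' hx
        simp only [Finset.mem_singleton, forall_eq]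
        constructor
        · rintro ⟨a, ha, b, hb, c, hc, d, hd, h1, h2, h3⟩
          exact hB b hb (hint B (by simp) a ha c hc b (hsub hb) h1 h2)
        · rintro ⟨a, ha, b, hb, c, hc, d, hd, h1, h2, h3⟩
          exact hB c hc (hint B (by simp) b hb d hd c (hsub hc) h2 h3))
      (fun P₁ P₂ => (∏ V ∈ P₁, f V) *
        if ∀ C ∈ L, ¬ IsSaturated C.2 P₂ then ∏ V ∈ P₂, f V else 0)
    have href : ∀ P₂ ∈ ncParts pos (support L ∪ R), Refines P₂ {support L ∪ R} :=
      fun P hP V hV => ⟨_, Finset.mem_singleton_self _, (mem_ncParts.1 hP).1.subset hV⟩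
    rw [Finset.filter_true_of_mem href, ← Finset.sum_mul_sum, ← Finset.sum_filter] at key
    rw [smul_eq_mul, ncSum, ← key, Finset.sum_filter, Finset.sum_filter, Finset.sum_filter,
      ← Finset.sum_sub_distrib]
    refine Finset.sum_congr rfl fun P hP => ?_
    have hP' := (mem_ncParts.1 hP).1
    have hsat : Refines P (insert B.2 {support L ∪ R}) ↔ IsSaturated B.2 P := by
      refine forall₂_congr fun V hV => ?_
      simp only [Finset.mem_insert, Finset.mem_singleton, exists_eq_or_imp, exists_eq_left]
      refine or_congr_right ⟨fun h => (hBd.mono_right h).symm, fun h x hx => ?_⟩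
      have := hP'.subset hV hx
      rw [support_cons, Finset.union_assoc, Finset.mem_union] at this
      exact this.resolve_left fun hxB => Finset.disjoint_left.1 h hx hxB
    -- Blocks inside `B.2` are disjoint from the other intervals and do not affect their saturation.
    have hsat' : (∀ C ∈ L, ¬ IsSaturated C.2 (P.filter fun V => ¬ V ⊆ B.2)) ↔
        ∀ C ∈ L, ¬ IsSaturated C.2 P := by
      refine forall₂_congr fun C hC => not_congr
        ⟨fun h V hV => ?_, fun h V hV => h V (Finset.mem_filter.1 hV).1⟩
      by_cases hVB : V ⊆ B.2
      · exact Or.inr (Finset.disjoint_of_subset_left hVB (hd'.1 C hC))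
      · exact h V (Finset.mem_filter.2 ⟨hV, hVB⟩)
    simp only [hsat, hsat', List.forall_mem_cons]
    by_cases h1 : IsSaturated B.2 P
    · by_cases h2 : ∀ C ∈ L, ¬ IsSaturated C.2 P
      · simp only [h1, if_true, not_true, false_and, if_false, if_pos h2,
          Finset.prod_filter_mul_prod_filter_not, sub_self]
      · simp only [h1, if_true, not_true, false_and, if_false, if_neg h2, mul_zero, sub_self]
    · simp [h1]

/-- For a non-crossing partition into monochromatic blocks, one of the maximal monochromatic
intervals is a union of blocks. -/
lemma exists_isSaturated {pos : κ → β} {ε : κ → ι} {L : List (ι × Finset κ)} (hne : L ≠ [])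
    (hL : IsIntervals pos ε L) {P : Finset (Finset κ)} (hP : P ∈ ncParts pos (support L))
    (hmono : ∀ V ∈ P, ∀ x ∈ V, ∀ y ∈ V, ε x = ε y) : ∃ B ∈ L, IsSaturated B.2 P := by
  obtain ⟨hP, hnc⟩ := mem_ncParts.1 hP
  by_contra! hcon
  have hlt := List.pairwise_iff_getElem.1 hL.lt
  have hch := List.isChain_iff_getElem.1 hL.ne
  have hcol : ∀ (i : ℕ) (hi : i < L.length), ∀ x ∈ L[i].2, ε x = L[i].1 :=
    fun i hi => hL.color _ (List.getElem_mem hi)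
  -- every interval shares a block with another one
  have hex : ∀ (i : ℕ) (hi : i < L.length), ∃ V ∈ P, ∃ x ∈ V, x ∈ L[i].2 ∧
      ∃ y ∈ V, ∃ (j : ℕ) (hj : j < L.length), j ≠ i ∧ y ∈ L[j].2 := by
    intro i hi
    have := hcon L[i] (List.getElem_mem hi)
    simp only [IsSaturated, not_forall, not_or] at this
    obtain ⟨V, hV, hVi, hdis⟩ := this
    obtain ⟨x, hxV, hxi⟩ := Finset.not_disjoint_iff.1 hdis
    obtain ⟨y, hyV, hyi⟩ := Finset.not_subset.1 hVi
    obtain ⟨C, hC, hyC⟩ := mem_support.1 (hP.subset hV hyV)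
    obtain ⟨j, hj, rfl⟩ := List.mem_iff_getElem.1 hC
    exact ⟨V, hV, x, hxV, hxi, y, hyV, j, hj, fun h => by subst h; exact hyi hyC, hyC⟩
  -- Descent on the distance `j - i` between two intervals that meet a common block.
  have key : ∀ (d i j : ℕ) (hi : i < L.length) (hj : j < L.length), i < j → j - i = d →
      ∀ V ∈ P, ∀ x ∈ V, ∀ y ∈ V, x ∈ L[i].2 → y ∈ L[j].2 → False := by
    intro d
    induction d using Nat.strong_induction_on with
    | _ d ih =>
      intro i j hi hj hij hd V hV x hx y hy hxi hyj
      have hc : L[i].1 = L[j].1 := by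
        rw [← hcol i hi x hxi, ← hcol j hj y hyj]; exact hmono V hV x hx y hy
      have hi1 : i + 1 < j := by
        rcases Nat.lt_or_ge (i + 1) j with h | h
        · exact h
        · obtain rfl : j = i + 1 := by omega
          exact (hch i hj hc).elim
      -- Interval `i + 1` has another colour than interval `i`, so its block `V'` differs from `V`.
      -- As `V` encloses it, a partner `k` outside `i, …, j` would give a crossing; hence `k` lies
      -- in this range, at distance less than `d` from `i + 1`.
      obtain ⟨V', hV', x', hx', hxi', y', hy', k, hk, hki, hyk⟩ := hex (i + 1) (by omega)
      have hVV : V ≠ V' := by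
        rintro rfl
        refine hch i (by omega) ?_
        rw [← hcol i hi x hxi, ← hcol (i + 1) (by omega) x' hxi']
        exact hmono V hV x hx x' hx'
      have hxx' := hlt i (i + 1) hi (by omega) (by omega) x hxi x' hxi'
      have hxy' := hlt (i + 1) j (by omega) hj hi1 x' hxi' y hyj
      rcases Nat.lt_or_ge k i with h | h
      · exact hnc V' hV' V hV hVV.symm
          ⟨y', hy', x, hx, x', hx', y, hy, hlt k i hk hi h y' hyk x hxi, hxx', hxy'⟩
      rcases Nat.lt_or_ge j k with h' | h'
      · exact hnc V hV V' hV' hVV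
          ⟨x, hx, x', hx', y, hy, y', hy', hxx', hxy', hlt j k hj hk h' y hyj y' hyk⟩
      rcases Nat.lt_or_ge k (i + 1) with h'' | h''
      · exact ih (i + 1 - k) (by omega) k (i + 1) hk (by omega) h'' rfl V' hV' y' hy' x' hx'
          hyk hxi'
      · exact ih (k - (i + 1)) (by omega) (i + 1) k (by omega) hk (by omega) rfl V' hV' x' hx'
          y' hy' hxi' hyk
  obtain ⟨V, hV, x, hx, hxi, y, hy, j, hj, hj0, hyj⟩ := hex 0 (List.length_pos_of_ne_nil hne)
  exact key _ 0 j _ hj (Nat.pos_of_ne_zero hj0) rfl V hV x hx y hy hxi hyj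

open Classical in
/-- The function `f`, restricted to monochromatic sets. -/
def restrictMono (ε : κ → ι) (f : Finset κ → ℂ) (V : Finset κ) : ℂ :=
  if ∀ x ∈ V, ∀ y ∈ V, ε x = ε y then f V else 0

/-- The centered sums of a sum over non-crossing partitions with monochromatic blocks vanish. -/
lemma centeredSum_ncSum_eq_zero {pos : κ → β} {ε : κ → ι} (f : Finset κ → ℂ)
    (ψ : ι × Finset κ → ℂ) {L : List (ι × Finset κ)} (hne : L ≠ []) (hL : IsIntervals pos ε L)
    (hψ : ∀ B ∈ L, ψ B = ncSum pos (restrictMono ε f) B.2) :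
    centeredSum ψ (ncSum pos (restrictMono ε f)) L ∅ = 0 := by
  classical
  have hsym : ∀ B ∈ L, ∀ C ∈ L, B ≠ C →
      (∀ x ∈ B.2, ∀ y ∈ C.2, pos x < pos y) ∨ (∀ x ∈ B.2, ∀ y ∈ C.2, pos y < pos x) := by
    intro B hB C hC hBC
    obtain ⟨i, hi, rfl⟩ := List.mem_iff_getElem.1 hB
    obtain ⟨j, hj, rfl⟩ := List.mem_iff_getElem.1 hC
    have hlt := List.pairwise_iff_getElem.1 hL.lt
    rcases lt_trichotomy i j with h | rfl | h
    · exact Or.inl (hlt i j hi hj h)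
    · exact (hBC rfl).elim
    · exact Or.inr fun x hx y hy => hlt j i hj hi h y hy x hx
  rw [centeredSum_ncSum (restrictMono ε f) ψ L ∅ hψ
    (hL.lt.imp fun h => Finset.disjoint_left.2 fun x hx hx' => (h x hx x hx').false) (by simp)]
  · refine Finset.sum_eq_zero fun P hP => ?_
    rw [Finset.mem_filter, Finset.union_empty] at hP
    by_contra h0
    rw [Finset.prod_eq_zero_iff] at h0
    -- A nonzero term has only monochromatic blocks, hence a saturated interval, which the filter
    -- excludes.
    obtain ⟨B, hB, hsat⟩ := exists_isSaturated hne hL hP.1 fun V hV x hx y hy => by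
      by_contra hxy
      exact h0 ⟨V, hV, if_neg fun h => hxy (h x hx y hy)⟩
    exact hP.2 B hB hsat
  · intro B hB a ha c hc b hb hab hbc
    rw [Finset.union_empty] at hb
    obtain ⟨C, hC, hbC⟩ := mem_support.1 hb
    by_cases hBC : B = C
    · rwa [hBC]
    · rcases hsym B hB C hC hBC with h | h
      · exact ((h c hc b hbC).trans hbc).false.elim
      · exact ((h a ha b hbC).trans hab).false.elim

lemma ncSum_restrictMono {pos : κ → β} {ε : κ → ι} (f : Finset κ → ℂ) {S : Finset κ}
    (hS : ∀ x ∈ S, ∀ y ∈ S, ε x = ε y) : ncSum pos (restrictMono ε f) S = ncSum pos f S := by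
  refine Finset.sum_congr rfl fun P hP => Finset.prod_congr rfl fun V hV => if_pos ?_
  have := (mem_ncParts.1 hP).1.subset hV
  exact fun x hx y hy => hS x (this hx) y (this hy)

/-! ### Cumulants -/

/-- The cumulants of a function `φ` of finite sets, with `φ S = ∑_P ∏_{V ∈ P} cumulant φ V`. -/
def cumulant (pos : κ → β) (φ : Finset κ → ℂ) : Finset κ → ℂ :=
  Finset.strongInduction fun S ih =>
    φ S - ∑ P ∈ (ncParts pos S).erase {S}, ∏ V ∈ P, if h : V ⊂ S then ih V h else 0

/-- The one-block partition contributes `cumulant pos φ S`, which was defined to make up the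
difference. The empty set is separate, because `{∅}` is not a partition of it. -/
lemma ncSum_cumulant (pos : κ → β) {φ : Finset κ → ℂ} (h0 : φ ∅ = 1) (S : Finset κ) :
    ncSum pos (cumulant pos φ) S = φ S := by
  rcases S.eq_empty_or_nonempty with rfl | hS
  · rw [ncSum_empty, h0]
  have hmem : {S} ∈ ncParts pos S := by
    rw [mem_ncParts]
    refine ⟨⟨by simpa using hS, by simp, by simp⟩, ?_⟩
    intro V hV W hW h
    rw [Finset.mem_singleton] at hV hW
    exact (h (hV.trans hW.symm)).elim
  rw [ncSum, ← Finset.add_sum_erase _ _ hmem, Finset.prod_singleton, cumulant,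
    Finset.strongInduction_eq, sub_add_eq_add_sub, sub_eq_iff_eq_add, ← cumulant]
  congr 1
  refine Finset.sum_congr rfl fun P hP => Finset.prod_congr rfl fun V hV => ?_
  rw [Finset.mem_erase, mem_ncParts] at hP
  obtain ⟨hPS, hP, -⟩ := hP
  -- Only proper subsets occur as blocks here, so the default value `0` in the recursion is never
  -- used.
  have hVS : V ⊂ S := by
    refine (hP.subset hV).ssubset_of_ne ?_
    rintro rfl
    refine hPS (Finset.eq_singleton_iff_unique_mem.2 ⟨hV, fun W hW => ?_⟩)
    obtain ⟨x, hx⟩ := hP.nonempty W hW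
    exact hP.eq_of_mem W hW V hV x hx (hP.subset hW hx)
  rw [dif_pos hVS]

end NonCrossing

/-! ### Moments in the free product as sums over non-crossing partitions -/

section Moments

variable {ι : Type} [DecidableEq ι] {X : ι → PointedSpace} {κ β : Type*} [LinearOrder κ]
  [LinearOrder β] {pos : κ → β} {side : κ → Bool}

lemma PointedSpace.state_one (Y : PointedSpace) : Y.state 1 = 1 := Y.p_ξ

/-- Mixed cumulants vanish in the free product. -/
theorem state_eq_ncSum (hinj : Function.Injective pos) (hpos : Compatible pos side) (ε : κ → ι)
    (S : κ → ∀ i, Module.End ℂ (X i).carrier) (U : Finset κ) :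
    (freeProduct X).state (orderedProd (rep X side ε S) U) =
      ncSum pos (restrictMono ε (cumulant pos fun U =>
        (freeProduct X).state (orderedProd (rep X side ε S) U))) U := by
  have h0 : (freeProduct X).state (orderedProd (rep X side ε S) ∅) = 1 := by
    rw [orderedProd_empty, PointedSpace.state_one]
  refine eq_of_centeredSum_eq_zero pos hinj ε (blockMoment X S)
    (f := fun U => (freeProduct X).state (orderedProd (rep X side ε S) U)) ?_
    (fun L hne hL => centeredSum_moment_eq_zero hpos hne hL)
    (fun L hne hL => centeredSum_ncSum_eq_zero _ _ hne hL fun B hB => ?_) U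
  · simp only [h0, ncSum_empty]
  -- On a single interval the restriction to monochromatic blocks is void, so the cumulant sum is
  -- the moment there, which is the centring constant.
  · have hcol := hL.color B hB
    rw [ncSum_restrictMono _ fun x hx y hy => (hcol x hx).trans (hcol y hy).symm,
      ncSum_cumulant pos h0, state_orderedProd_rep hpos hcol]

end Moments

/-! ### Möbius inversion -/

/-- Inversion recovers `f y` as the sum of `μ(x, y) g(x)` over `x ≤ y`; summing over the `y` with `p
y` and exchanging the sums gives the claim. -/
lemma sum_mu_mul {Q : Type*} [PartialOrder Q] [Fintype Q] [LocallyFiniteOrder Q] [DecidableEq Q]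
    (p : Q → Prop) [DecidablePred p] [∀ x, DecidablePred fun y => x ≤ y ∧ p y]
    [∀ x : Q, DecidablePred fun y => y ≤ x] {f g : Q → ℂ} (h : ∀ x, g x = ∑ y with y ≤ x, f y) :
    ∑ x, (∑ y with x ≤ y ∧ p y, IncidenceAlgebra.mu ℂ x y) * g x = ∑ y with p y, f y := by
  classical
  have h1 : ∀ y, ∑ x with x ≤ y, IncidenceAlgebra.mu ℂ x y * g x = f y := by
    intro y
    calc ∑ x with x ≤ y, IncidenceAlgebra.mu ℂ x y * g x
        = ∑ x, ∑ z, if z ≤ x ∧ x ≤ y then IncidenceAlgebra.mu ℂ x y * f z else 0 := by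
          rw [Finset.sum_filter]
          refine Finset.sum_congr rfl fun x _ => ?_
          split_ifs with hx
          · simp only [hx, and_true]
            rw [h, Finset.mul_sum, Finset.sum_filter]
          · simp [hx]
      _ = ∑ z, (∑ x ∈ Finset.Icc z y, IncidenceAlgebra.mu ℂ x y) * f z := by
          rw [Finset.sum_comm]
          refine Finset.sum_congr rfl fun z _ => ?_
          rw [Finset.sum_mul, ← Finset.sum_filter]
          exact Finset.sum_congr (by ext; simp) fun _ _ => rfl
      _ = f y := by simp [IncidenceAlgebra.sum_Icc_mu_left]
  calc ∑ x, (∑ y with x ≤ y ∧ p y, IncidenceAlgebra.mu ℂ x y) * g x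
      = ∑ x, ∑ y, if p y then (if x ≤ y then IncidenceAlgebra.mu ℂ x y * g x else 0) else 0 := by
        refine Finset.sum_congr rfl fun x _ => ?_
        rw [Finset.sum_mul, Finset.sum_filter]
        refine Finset.sum_congr rfl fun y _ => ?_
        by_cases hp : p y <;> by_cases hx : x ≤ y <;> simp [hp, hx]
    _ = ∑ y with p y, f y := by
        rw [Finset.sum_comm, Finset.sum_filter]
        refine Finset.sum_congr rfl fun y _ => ?_
        split_ifs
        · rw [← Finset.sum_filter, h1]
        · simp

/-! ### Bi-non-crossing partitions and non-crossing partitions -/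

section BNC

variable {I J : Type*} {n : ℕ} (α : Fin n → I ⊕ J)

/-- The order of the positions given by the permutation `s_α`. -/
def chiPos : Fin n → Fin n := (sPerm α).symm

lemma chiPos_injective : Function.Injective (chiPos α) := (sPerm α).symm.injective

/-- A left position is sent to its rank among the left positions, and a right position to its
reversed rank, shifted by the number of left positions. -/
lemma compatible_chiPos : Compatible (chiPos α) fun k => (α k).isLeft := by
  have hmem : ∀ k, k ∈ leftPositions α ↔ (α k).isLeft = true := by simp [leftPositions]
  have hl : ∀ k, (α k).isLeft = true → ∃ i : Fin (leftPositions α).card,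
      (leftPositions α).orderEmbOfFin rfl i = k ∧ (chiPos α k : ℕ) = i := by
    intro k hk
    obtain ⟨i, rfl⟩ : k ∈ Set.range ((leftPositions α).orderEmbOfFin rfl) := by
      simpa using (hmem k).2 hk
    refine ⟨i, rfl, ?_⟩
    have : chiPos α ((leftPositions α).orderEmbOfFin rfl i) =
        Fin.cast (by rw [Finset.card_add_card_compl, Fintype.card_fin])
          (Fin.castAdd ((leftPositions α)ᶜ).card i) := by
      rw [chiPos, Equiv.symm_apply_eq]
      simp [sPerm]
    rw [this]
    rfl
  have hr : ∀ k, ¬ (α k).isLeft = true → ∃ i : Fin ((leftPositions α)ᶜ).card,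
      (leftPositions α)ᶜ.orderEmbOfFin rfl i = k ∧
        (chiPos α k : ℕ) = (leftPositions α).card + (((leftPositions α)ᶜ).card - (i + 1)) := by
    intro k hk
    obtain ⟨i, rfl⟩ : k ∈ Set.range ((leftPositions α)ᶜ.orderEmbOfFin rfl) := by
      simpa using fun h => hk ((hmem k).1 h)
    refine ⟨i, rfl, ?_⟩
    have : chiPos α ((leftPositions α)ᶜ.orderEmbOfFin rfl i) =
        Fin.cast (by rw [Finset.card_add_card_compl, Fintype.card_fin])
          (Fin.natAdd (leftPositions α).card (Fin.rev i)) := by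
      rw [chiPos, Equiv.symm_apply_eq]
      simp [sPerm]
    rw [this]
    simp
  intro k l hkl
  split_ifs with hk
  · obtain ⟨i, hi, hki⟩ := hl k hk
    rw [Fin.lt_def, hki]
    by_cases hl' : (α l).isLeft = true
    · obtain ⟨j, hj, hlj⟩ := hl l hl'
      rw [hlj]
      rw [← hi, ← hj] at hkl
      simpa using hkl
    · obtain ⟨j, hj, hlj⟩ := hr l hl'
      omega
  · obtain ⟨i, hi, hki⟩ := hr k hk
    rw [Fin.lt_def, hki]
    by_cases hl' : (α l).isLeft = true
    · obtain ⟨j, hj, hlj⟩ := hl l hl'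
      omega
    · obtain ⟨j, hj, hlj⟩ := hr l hl'
      rw [← hi, ← hj] at hkl
      have : i < j := by simpa using hkl
      omega

lemma isPart_parts (π : Part n) : IsPart π.parts Finset.univ where
  nonempty _ hV := π.nonempty_of_mem_parts hV
  eq_of_mem _ hV _ hW _ hxV hxW := π.eq_of_mem_parts hV hW hxV hxW
  mem_iff x := by simpa using π.exists_mem (Finset.mem_univ x)

lemma isNonCrossing_permPart_iff (π : Part n) :
    IsNonCrossing (permPart (sPerm α)⁻¹ π) ↔ π.parts ∈ ncParts (chiPos α) Finset.univ := by
  have hmem : ∀ (V : Finset (Fin n)) (a : Fin n),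
      a ∈ V.map ((sPerm α)⁻¹).toEmbedding ↔ sPerm α a ∈ V := by
    intro V a
    rw [Finset.mem_map_equiv]
    rfl
  have hparts : (permPart (sPerm α)⁻¹ π).parts =
      π.parts.map ((sPerm α)⁻¹).finsetCongr.toEmbedding := rfl
  rw [mem_ncParts, and_iff_right (isPart_parts π), IsNonCrossing, hparts]
  simp only [Finset.forall_mem_map]
  refine forall₂_congr fun V hV => forall₂_congr fun W hW => ?_
  have hne : ((sPerm α)⁻¹.finsetCongr.toEmbedding V ≠ (sPerm α)⁻¹.finsetCongr.toEmbedding W) ↔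
      V ≠ W := ((sPerm α)⁻¹.finsetCongr.toEmbedding.injective).ne_iff
  rw [hne]
  refine forall_congr' fun _ => ?_
  constructor
  · rintro h ⟨a, ha, b, hb, c, hc, d, hd, h1, h2, h3⟩
    exact h _ _ _ _ h1 h2 h3 ((hmem V _).2 (by simpa [chiPos] using ha))
      ((hmem V _).2 (by simpa [chiPos] using hc)) ((hmem W _).2 (by simpa [chiPos] using hb))
      ((hmem W _).2 (by simpa [chiPos] using hd))
  · intro h a b c d h1 h2 h3 ha hc hb hd
    exact h ⟨_, (hmem V a).1 ha, _, (hmem W b).1 hb, _, (hmem V c).1 hc, _, (hmem W d).1 hd,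
      by simpa [chiPos] using ⟨h1, h2, h3⟩⟩

lemma sum_BNC {M : Type*} [AddCommMonoid M] (p : Finset (Finset (Fin n)) → Prop)
    [DecidablePred p] [DecidablePred fun π : BNC α => p π.1.parts]
    (F : Finset (Finset (Fin n)) → M) :
    ∑ π : BNC α with p π.1.parts, F π.1.parts =
      ∑ P ∈ ncParts (chiPos α) Finset.univ with p P, F P := by
  refine Finset.sum_nbij (fun π => π.1.parts) ?_ ?_ ?_ fun _ _ => rfl
  · intro π hπ
    rw [Finset.mem_filter] at hπ ⊢
    exact ⟨(isNonCrossing_permPart_iff α π.1).1 π.2, hπ.2⟩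
  · intro π _ σ _ h
    exact Subtype.ext (Finpartition.ext h)
  · intro P hP
    rw [Finset.mem_coe, Finset.mem_filter] at hP
    have hP' := (mem_ncParts.1 hP.1).1
    let π : Part n := Finpartition.ofExistsUnique P (fun _ _ => Finset.subset_univ _)
      (fun x _ => by
        obtain ⟨V, hV, hx⟩ := (hP'.mem_iff x).1 (Finset.mem_univ x)
        exact ⟨V, ⟨hV, hx⟩, fun W hW => hP'.eq_of_mem W hW.1 V hV x hW.2 hx⟩)
      (fun h => Finset.not_nonempty_empty (hP'.nonempty _ h))
    exact ⟨⟨π, (isNonCrossing_permPart_iff α π).2 hP.1⟩, by simpa [π] using hP.2, rfl⟩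

lemma le_shadingPart_iff (σ : Part n) (ε : Fin n → Fin 2) :
    σ ≤ shadingPart ε ↔ ∀ V ∈ σ.parts, ∀ x ∈ V, ∀ y ∈ V, ε x = ε y := by
  classical
  have hrel : ∀ x y, y ∈ (shadingPart ε).part x ↔ ε x = ε y := fun x y => by
    rw [shadingPart, Finpartition.mem_part_ofSetoid_iff_rel]
    rfl
  constructor
  · intro h V hV x hx y hy
    obtain ⟨C, hC, hVC⟩ := h hV
    rw [← hrel, (shadingPart ε).part_eq_of_mem hC (hVC hx)]
    exact hVC hy
  · intro h V hV
    obtain ⟨x, hx⟩ := σ.nonempty_of_mem_parts hV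
    exact ⟨(shadingPart ε).part x, (shadingPart ε).part_mem.2 (Finset.mem_univ x),
      fun y hy => (hrel x y).2 (h V hV x hx y hy)⟩

open Classical in
/-- Moments that are sums over non-crossing partitions of products of cumulants of
monochromatic blocks satisfy the moment formula. -/
lemma sum_muBNC_mul (ε : Fin n → Fin 2) {m : Finset (Fin n) → ℂ} (h0 : m ∅ = 1) :
    ∑ π : BNC α, (∑ σ : BNC α with π ≤ σ ∧ σ.1 ≤ shadingPart ε, muBNC α π σ) *
        ∏ V ∈ π.1.parts, m V =
      ncSum (chiPos α) (restrictMono ε (cumulant (chiPos α) m)) Finset.univ := by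
  have hmoment : ∀ σ : BNC α, ∏ V ∈ σ.1.parts, m V =
      ∑ π : BNC α with π ≤ σ, ∏ V ∈ π.1.parts, cumulant (chiPos α) m V := by
    intro σ
    have h1 := sum_ncParts_refines (cumulant (chiPos α) m)
      ((isNonCrossing_permPart_iff α σ.1).1 σ.2)
    simp only [ncSum_cumulant _ h0] at h1
    rw [← h1, ← sum_BNC α (fun P => Refines P σ.1.parts)]
    -- The order on `Part n` is `Refines` on the sets of blocks by definition.
    exact Finset.sum_congr (Finset.filter_congr fun π _ => Iff.rfl) fun _ _ => rfl
  simp only [muBNC]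
  rw [sum_mu_mul (fun σ : BNC α => σ.1 ≤ shadingPart ε) hmoment]
  simp only [le_shadingPart_iff]
  rw [sum_BNC α (fun P => ∀ V ∈ P, ∀ x ∈ V, ∀ y ∈ V, ε x = ε y)
    (fun P => ∏ V ∈ P, cumulant (chiPos α) m V), ncSum, Finset.sum_filter]
  refine Finset.sum_congr rfl fun P _ => ?_
  split_ifs with h
  · exact Finset.prod_congr rfl fun V hV => (if_pos (h V hV)).symm
  · push Not at h
    obtain ⟨V, hV, x, hx, y, hy, hxy⟩ := h
    exact (Finset.prod_eq_zero hV (if_neg fun h => hxy (h x hx y hy))).symm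

end BNC

/-! ### The moment formula -/

section MomentFormula

lemma orderedProd_univ {A : Type*} [Monoid A] {n : ℕ} (T : Fin n → A) :
    orderedProd T Finset.univ = (List.ofFn T).prod := by
  rw [orderedProd, Fin.sort_univ, List.ofFn_eq_map]

lemma orderedProd_congr {κ A : Type*} [LinearOrder κ] [Monoid A] {T T' : κ → A} {S : Finset κ}
    (h : ∀ k ∈ S, T k = T' k) : orderedProd T S = orderedProd T' S := by
  rw [orderedProd, orderedProd,
    List.map_congr_left fun k hk => h k ((Finset.mem_sort _).1 hk)]

lemma map_orderedProd {κ A B F : Type*} [LinearOrder κ] [Monoid A] [Monoid B] [FunLike F A B]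
    [MonoidHomClass F A B] (f : F) (T : κ → A) (S : Finset κ) :
    f (orderedProd T S) = orderedProd (fun k => f (T k)) S := by
  rw [orderedProd, orderedProd, map_list_prod, List.map_map]
  rfl

variable {I J : Type*} {n : ℕ} (α : Fin n → I ⊕ J) (ε : Fin n → Fin 2)

open Classical in
/-- The moment formula holds in the free product. -/
theorem state_ofFn_rep {X : Fin 2 → PointedSpace}
    (S : Fin n → ∀ e, Module.End ℂ (X e).carrier) :
    let T := rep X (fun k => (α k).isLeft) ε S
    (freeProduct X).state (List.ofFn T).prod =
      ∑ π : BNC α, (∑ σ : BNC α with π ≤ σ ∧ σ.1 ≤ shadingPart ε, muBNC α π σ) *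
        momentPart (freeProduct X).state π.1 T := by
  intro T
  rw [← orderedProd_univ, state_eq_ncSum (chiPos_injective α) (compatible_chiPos α) ε S,
    ← sum_muBNC_mul α ε (by rw [orderedProd_empty, PointedSpace.state_one])]
  rfl

open Classical in
/-- The moment formula depends only on the moments of monochromatic sets. -/
lemma sum_muBNC_momentPart_congr {A B : Type*} [Ring A] [Algebra ℂ A] [Ring B] [Algebra ℂ B]
    {φ : A →ₗ[ℂ] ℂ} {ψ : B →ₗ[ℂ] ℂ} {T : Fin n → A} {T' : Fin n → B}
    (h : ∀ V : Finset (Fin n), (∀ x ∈ V, ∀ y ∈ V, ε x = ε y) →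
      φ (orderedProd T V) = ψ (orderedProd T' V)) :
    ∑ π : BNC α, (∑ σ : BNC α with π ≤ σ ∧ σ.1 ≤ shadingPart ε, muBNC α π σ) *
        momentPart φ π.1 T =
      ∑ π : BNC α, (∑ σ : BNC α with π ≤ σ ∧ σ.1 ≤ shadingPart ε, muBNC α π σ) *
        momentPart ψ π.1 T' := by
  refine Finset.sum_congr rfl fun π _ => ?_
  by_cases hπ : π.1 ≤ shadingPart ε
  · congr 1
    exact Finset.prod_congr rfl fun V hV => h V ((le_shadingPart_iff π.1 ε).1 hπ V hV)
  -- No `σ` satisfies `π ≤ σ ≤ ε`, so both coefficients are empty sums.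
  · rw [Finset.filter_false_of_mem fun σ _ hσ => hπ (le_trans hσ.1 hσ.2), Finset.sum_empty,
      zero_mul, zero_mul]

end MomentFormula

/-! ### Bi-freeness and the moment formula -/

lemma jointDistribution_word {A K : Type*} [Ring A] [Algebra ℂ A] (φ : A →ₗ[ℂ] ℂ) (a : K → A)
    (w : List K) :
    jointDistribution φ a (w.map (FreeAlgebra.ι ℂ)).prod = φ (w.map a).prod := by
  simp [jointDistribution, map_list_prod, Function.comp_def]

/-- The words form a basis of the free algebra. -/
lemma jointDistribution_eq_iff {A B K : Type*} [Ring A] [Algebra ℂ A] [Ring B] [Algebra ℂ B]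
    {φ : A →ₗ[ℂ] ℂ} {ψ : B →ₗ[ℂ] ℂ} {a : K → A} {b : K → B} :
    jointDistribution φ a = jointDistribution ψ b ↔
      ∀ w : List K, φ (w.map a).prod = ψ (w.map b).prod := by
  constructor
  · intro h w
    rw [← jointDistribution_word φ a, ← jointDistribution_word ψ b, h]
  · intro h
    refine (FreeAlgebra.basisFreeMonoid ℂ K).ext fun w => ?_
    have hb : FreeAlgebra.basisFreeMonoid ℂ K w =
        ((FreeMonoid.toList w).map (FreeAlgebra.ι ℂ)).prod := by
      simp [FreeAlgebra.basisFreeMonoid, FreeAlgebra.equivMonoidAlgebraFreeMonoid,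
        FreeMonoid.lift_apply]
    rw [hb, jointDistribution_word, jointDistribution_word, h]

section Main

variable {I J A : Type*} [Ring A] [Algebra ℂ A] {z : Fin 2 → TwoFacedFamily I J A}
  {X : Fin 2 → PointedSpace}

/-- The operators on the factors that represent the elements of two two-faced families. -/
def factorElem
    (l : ∀ e, Algebra.adjoin ℂ (Set.range (z e).left) →ₐ[ℂ] Module.End ℂ (X e).carrier)
    (r : ∀ e, Algebra.adjoin ℂ (Set.range (z e).right) →ₐ[ℂ] Module.End ℂ (X e).carrier) :
    I ⊕ J → ∀ e, Module.End ℂ (X e).carrier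
  | .inl i, e => l e ⟨(z e).left i, Algebra.subset_adjoin ⟨i, rfl⟩⟩
  | .inr j, e => r e ⟨(z e).right j, Algebra.subset_adjoin ⟨j, rfl⟩⟩

/-- The families of operators on the free product that occur in the definition of bi-freeness. -/
def freeFamily
    (l : ∀ e, Algebra.adjoin ℂ (Set.range (z e).left) →ₐ[ℂ] Module.End ℂ (X e).carrier)
    (r : ∀ e, Algebra.adjoin ℂ (Set.range (z e).right) →ₐ[ℂ] Module.End ℂ (X e).carrier)
    (e : Fin 2) : TwoFacedFamily I J (Module.End ℂ (freeProduct X).carrier) where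
  left i := leftRep X e (l e ⟨(z e).left i, Algebra.subset_adjoin ⟨i, rfl⟩⟩)
  right j := rightRep X e (r e ⟨(z e).right j, Algebra.subset_adjoin ⟨j, rfl⟩⟩)

lemma freeFamily_elem
    (l : ∀ e, Algebra.adjoin ℂ (Set.range (z e).left) →ₐ[ℂ] Module.End ℂ (X e).carrier)
    (r : ∀ e, Algebra.adjoin ℂ (Set.range (z e).right) →ₐ[ℂ] Module.End ℂ (X e).carrier)
    {n : ℕ} (α : Fin n → I ⊕ J) (ε : Fin n → Fin 2) :
    (fun k => (freeFamily l r (ε k)).elem (α k)) =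
      rep X (fun k => (α k).isLeft) ε fun k => factorElem l r (α k) := by
  funext k
  rcases hk : α k with i | j <;>
    simp [rep, hk, freeFamily, TwoFacedFamily.elem, factorElem]

variable {φ : A →ₗ[ℂ] ℂ}

open Classical in
theorem IsBiFree.moment_formula (h : IsBiFree φ z) {n : ℕ} (α : Fin n → I ⊕ J)
    (ε : Fin n → Fin 2) :
    φ (List.ofFn fun k => (z (ε k)).elem (α k)).prod =
      ∑ π : BNC α, (∑ σ : BNC α with π ≤ σ ∧ σ.1 ≤ shadingPart ε, muBNC α π σ) *
        momentPart φ π.1 fun k => (z (ε k)).elem (α k) := by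
  obtain ⟨X, l, r, h⟩ := h
  have hw := jointDistribution_eq_iff.1 h
  -- All subsets are needed, not only the full product, since the formula involves the moments of
  -- blocks; each is the moment of a subword.
  have hmom : ∀ V : Finset (Fin n),
      (freeProduct X).state (orderedProd (fun k => (freeFamily l r (ε k)).elem (α k)) V) =
        φ (orderedProd (fun k => (z (ε k)).elem (α k)) V) := by
    intro V
    have := hw ((V.sort (· ≤ ·)).map fun k => (ε k, α k))
    rw [List.map_map, List.map_map] at this
    exact this
  rw [← sum_muBNC_momentPart_congr α ε fun V _ => hmom V, ← orderedProd_univ, ← hmom,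
    orderedProd_univ, freeFamily_elem]
  exact state_ofFn_rep α ε _

/-- The algebra `A` as a vector space with specified state-vector. -/
def regularSpace (φ : A →ₗ[ℂ] ℂ) (hφ : φ 1 = 1) : PointedSpace where
  carrier := A
  p := φ
  ξ := 1
  p_ξ := hφ

/-- The left regular representation of a subalgebra. -/
def regularRep (φ : A →ₗ[ℂ] ℂ) (hφ : φ 1 = 1) (B : Subalgebra ℂ A) :
    B →ₐ[ℂ] Module.End ℂ (regularSpace φ hφ).carrier :=
  (Algebra.lmul ℂ A).comp B.val

open Classical in
-- The model is `A` itself for both colours. Right faces too act by left multiplication, which keeps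
-- the factors of a monochromatic product in their original order.
theorem isBiFree_of_moment_formula (hφ : φ 1 = 1)
    (h : ∀ (n : ℕ) (α : Fin n → I ⊕ J) (ε : Fin n → Fin 2),
      φ (List.ofFn fun k => (z (ε k)).elem (α k)).prod =
        ∑ π : BNC α, (∑ σ : BNC α with π ≤ σ ∧ σ.1 ≤ shadingPart ε, muBNC α π σ) *
          momentPart φ π.1 fun k => (z (ε k)).elem (α k)) :
    IsBiFree φ z := by
  let X : Fin 2 → PointedSpace := fun _ => regularSpace φ hφ
  let l : ∀ e, Algebra.adjoin ℂ (Set.range (z e).left) →ₐ[ℂ] Module.End ℂ (X e).carrier :=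
    fun e => regularRep φ hφ _
  let r : ∀ e, Algebra.adjoin ℂ (Set.range (z e).right) →ₐ[ℂ] Module.End ℂ (X e).carrier :=
    fun e => regularRep φ hφ _
  refine ⟨X, l, r, jointDistribution_eq_iff.2 fun w => ?_⟩
  let α : Fin w.length → I ⊕ J := fun k => (w.get k).2
  let ε : Fin w.length → Fin 2 := fun k => (w.get k).1
  have hlist {C : Type _} (c : Fin 2 × (I ⊕ J) → C) :
      w.map c = List.ofFn fun k => c (ε k, α k) := by
    conv_lhs => rw [← List.ofFn_get w, List.map_ofFn]
    rfl
  rw [hlist, hlist, h]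
  change (freeProduct X).state (List.ofFn fun k => (freeFamily l r (ε k)).elem (α k)).prod = _
  rw [freeFamily_elem, state_ofFn_rep]
  refine sum_muBNC_momentPart_congr α ε fun V hV => ?_
  rcases V.eq_empty_or_nonempty with rfl | ⟨x, hx⟩
  · rw [orderedProd_empty, orderedProd_empty, PointedSpace.state_one, hφ]
  have hcol : ∀ y ∈ V, ε y = ε x := fun y hy => hV y hy x hx
  have hfac : ∀ k, factorElem l r (α k) (ε x) = Algebra.lmul ℂ A ((z (ε x)).elem (α k)) := by
    intro k
    rcases hk : α k with i | j <;> rfl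
  rw [state_orderedProd_rep (B := (ε x, V)) (compatible_chiPos α) hcol, blockMoment]
  simp only [hfac]
  have hmul : orderedProd (fun k => Algebra.lmul ℂ A ((z (ε x)).elem (α k))) V 1 =
      orderedProd (fun k => (z (ε x)).elem (α k)) V := by
    rw [← map_orderedProd]
    simp
  refine (congrArg φ hmul).trans ?_
  exact congrArg φ (orderedProd_congr fun k hk => by rw [hcol k hk])

end Main

end BiFree

end

open Classical in
theorem mainTheorem4 {I J A : Type*} [Ring A] [Algebra ℂ A]
    (φ : A →ₗ[ℂ] ℂ) (hφ : φ 1 = 1) (z' z'' : BiFree.TwoFacedFamily I J A) :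
    BiFree.IsBiFree φ ![z', z''] ↔
      ∀ (n : ℕ) (α : Fin n → I ⊕ J) (ε : Fin n → Fin 2),
        let zε : Fin n → A := fun k => (![z', z''] (ε k)).elem (α k)
        φ (List.ofFn zε).prod =
          ∑ π : BiFree.BNC α,
            (∑ σ : BiFree.BNC α with π ≤ σ ∧ σ.1 ≤ BiFree.shadingPart ε,
              BiFree.muBNC α π σ) * BiFree.momentPart φ π.1 zε := by
  exact ⟨fun h n α ε => h.moment_formula α ε, BiFree.isBiFree_of_moment_formula hφ⟩
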